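/- Let $f:\mathbb{R}^d\to\mathbb{R}$ be locally Lipschitz, let $R_1\ge 0$, $R_2>0$ and let $m\ge 0$ be an integer with $R_1=0$ if and only if $m=0$, and suppose that $$\sup_{\zeta\in\partial_C f(x)}\|\zeta\|\le R_1\|x\|^m+R_2\qquad\text{for all }x\in\mathbb{R}^d,$$ where $\|\cdot\|$ is the Euclidean norm, $0^0=1$, and $\partial_C f(x)=\{s:\langle s,v\rangle\le f^{\circ}(x;v)\ \forall v\}$ is the Clarke subdifferential, with $f^\circ(x;v)=\limsup_{x'\to x,\,t\downarrow 0}\frac{f(x'+tv)-f(x')}{t}$. (Such an $f$ is called subdifferentially polynomially bounded, SPB.) Assume that $\inf f>-\infty$. Let $\sigma>0$, let $(\tau_k)_{k\ge 0}\subset(0,1]$ and $x^0\in\mathbb{R}^d$, let $u^0,u^1,\dots$ be independent standard Gaussian vectors in $\mathbb{R}^d$, and for $k\ge 0$ set $$v^k=\frac{f(x^k+\sigma u^k)-f(x^k)}{\sigma}\,u^k,\qquad x^{k+1}=x^k-\tau_k\,\frac{v^k}{\|x^k\|^{2m}+1}.$$ Let $f_\sigma(x)=\mathbb{E}_{u\sim\mathcal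 N(0,I)}[f(x+\sigma u)]$ be the Gaussian smoothing of $f$. Put $$\mathcal A=2^{2m-2}R_1\sigma^{m-1}(m+1+d)^{\frac{m+1}{2}}+\sigma^{-1}R_2\sqrt d,\quad \mathcal B=2^{2m-2}\sigma^{-1}R_1\sqrt d,\quad \mathcal C=2^{m-1}\sigma^{-1}R_1\sqrt d,$$ $$\mathcal M(x)=(2^{m-1}R_1\|x\|^m+R_2)\sqrt d+2^{m-1}R_1\sigma^m(m+1+d)^{\frac{m+1}{2}},$$ and, for integers $p\ge 1$, $$\mathcal H_{(p)}=3^{p-1}\max\Big\{2^{(m-1)p}R_1^p(2p+d)^p,\ R_2^p(2p+d)^p+2^{(m-1)p}R_1^p\sigma^{mp}[(m+2)p+d]^{\frac{(m+2)p}{2}}\Big\}.$$ Then $f_\sigma$ is well defined (the defining expectation converges absolutely) and differentiable, with $\nabla f_\sigma(x)=\sigma^{-1}\mathbb{E}_{u\sim\mathcal N(0,I)}[f(x+\sigma u)u]$ for every $x$ (again with absolute convergence); for every $k\ge 0$ the random variables $f_\sigma(x^k)$ and $\big\|\frac{\nabla f_\sigma(x^k)}{\|x^k\|^m+1}\big\|^2$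 are integrable; for every $k\ge 0$, $$\mathbb{E}[f_\sigma(x^{k+1})]\le \mathbb{E}[f_\sigma(x^k)]+\frac{\mathcal H_{(2)}\tau_k^2(\mathcal A+\mathcal B)}{2}+\frac{\mathcal C}{m+2}\mathcal H_{(m+2)}\tau_k^{m+2};$$ and for every integer $T>0$, $$\min_{0\le k\le T}\mathbb{E}\bigg[\bigg\|\frac{\nabla f_\sigma(x^k)}{\|x^k\|^m+1}\bigg\|^2\bigg]\le\frac{\mathcal M(x^0)\sigma+f(x^0)-\inf f+\frac12\mathcal H_{(2)}(\mathcal A+\mathcal B)\sum_{k=0}^T\tau_k^2+\frac{\mathcal H_{(m+2)}\mathcal C}{m+2}\sum_{k=0}^T\tau_k^{m+2}}{\sum_{k=0}^T\tau_k}.$$ -/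

import Mathlib

open MeasureTheory ProbabilityTheory Filter Topology

noncomputable section

namespace SPB

/-- Clarke directional derivative
`f°(x; v) = limsup_{x' → x, t ↓ 0} (f (x' + t v) - f x') / t`. It is only used for locally
Lipschitz `f`, where the difference quotient is bounded near `(x, 0⁺)`. -/
def clarkeDeriv {d : ℕ} (f : EuclideanSpace ℝ (Fin d) → ℝ) (x v : EuclideanSpace ℝ (Fin d)) : ℝ :=
  limsup (fun p : EuclideanSpace ℝ (Fin d) × ℝ => (f (p.1 + p.2 • v) - f p.1) / p.2)
    (𝓝 x ×ˢ 𝓝[>] (0 : ℝ))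

/-- Clarke subdifferential of a locally Lipschitz function. -/
def clarkeSubdiff {d : ℕ} (f : EuclideanSpace ℝ (Fin d) → ℝ) (x : EuclideanSpace ℝ (Fin d)) :
    Set (EuclideanSpace ℝ (Fin d)) :=
  {s | ∀ v, inner ℝ s v ≤ clarkeDeriv f x v}

/-- `f` is subdifferentially polynomially bounded with parameters `R₁`, `R₂`, `m`.
The bound on every element of the subdifferential is the bound on the supremum of the norms.
For `m = 0` the convention `0 ^ 0 = 1` is in force. -/
structure IsSPB {d : ℕ} (f : EuclideanSpace ℝ (Fin d) → ℝ) (R₁ R₂ : ℝ) (m : ℕ) : Prop where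
  locallyLipschitz : LocallyLipschitz f
  R₁_nonneg : 0 ≤ R₁
  R₂_pos : 0 < R₂
  R₁_eq_zero_iff : R₁ = 0 ↔ m = 0
  norm_le : ∀ x, ∀ ζ ∈ clarkeSubdiff f x, ‖ζ‖ ≤ R₁ * ‖x‖ ^ m + R₂

/-- Gaussian smoothing `f_σ(x) = E[f (x + σ u)]`, `u ∼ N(0, I)`. -/
def smoothing {d : ℕ} (f : EuclideanSpace ℝ (Fin d) → ℝ) (σ : ℝ)
    (x : EuclideanSpace ℝ (Fin d)) : ℝ :=
  ∫ u, f (x + σ • u) ∂(stdGaussian (EuclideanSpace ℝ (Fin d)))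

/-- Two-point Gaussian estimator `σ⁻¹ (f (x + σ u) - f x) u`. -/
def estimator {d : ℕ} (f : EuclideanSpace ℝ (Fin d) → ℝ) (σ : ℝ)
    (x u : EuclideanSpace ℝ (Fin d)) : EuclideanSpace ℝ (Fin d) :=
  (1 / σ * (f (x + σ • u) - f x)) • u

/-- Iterates of the zeroth-order method started at `x₀`, with stepsizes
`τ k / (‖x^k‖^{2m} + 1)`, driven by the sequence `u` of directions. -/
def iterates {d : ℕ} (f : EuclideanSpace ℝ (Fin d) → ℝ) (m : ℕ) (σ : ℝ) (τ : ℕ → ℝ)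
    (x₀ : EuclideanSpace ℝ (Fin d)) (u : ℕ → EuclideanSpace ℝ (Fin d)) :
    ℕ → EuclideanSpace ℝ (Fin d)
  | 0 => x₀
  | k + 1 =>
      iterates f m σ τ x₀ u k -
        (τ k / (‖iterates f m σ τ x₀ u k‖ ^ (2 * m) + 1)) •
          estimator f σ (iterates f m σ τ x₀ u k) (u k)

/-- `𝒜 = 2^{2m-2} R₁ σ^{m-1} (m+1+d)^{(m+1)/2} + σ⁻¹ R₂ √d`. -/
def constA (d : ℕ) (R₁ R₂ : ℝ) (m : ℕ) (σ : ℝ) : ℝ :=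
  (2 : ℝ) ^ (2 * (m : ℤ) - 2) * R₁ * σ ^ ((m : ℤ) - 1) *
      ((m : ℝ) + 1 + d) ^ (((m : ℝ) + 1) / 2) +
    σ⁻¹ * R₂ * √(d : ℝ)

/-- `ℬ = 2^{2m-2} σ⁻¹ R₁ √d`. -/
def constB (d : ℕ) (R₁ : ℝ) (m : ℕ) (σ : ℝ) : ℝ :=
  (2 : ℝ) ^ (2 * (m : ℤ) - 2) * σ⁻¹ * R₁ * √(d : ℝ)

/-- `𝒞 = 2^{m-1} σ⁻¹ R₁ √d`. -/
def constC (d : ℕ) (R₁ : ℝ) (m : ℕ) (σ : ℝ) : ℝ :=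
  (2 : ℝ) ^ ((m : ℤ) - 1) * σ⁻¹ * R₁ * √(d : ℝ)

/-- `ℳ(x) = (2^{m-1} R₁ ‖x‖^m + R₂) √d + 2^{m-1} R₁ σ^m (m+1+d)^{(m+1)/2}`. -/
def constM {d : ℕ} (R₁ R₂ : ℝ) (m : ℕ) (σ : ℝ) (x : EuclideanSpace ℝ (Fin d)) : ℝ :=
  ((2 : ℝ) ^ ((m : ℤ) - 1) * R₁ * ‖x‖ ^ m + R₂) * √(d : ℝ) +
    (2 : ℝ) ^ ((m : ℤ) - 1) * R₁ * σ ^ m * ((m : ℝ) + 1 + d) ^ (((m : ℝ) + 1) / 2)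

/-- `ℋ_(0) = 1`, and for `p ≥ 1`, `ℋ_(p) = 3^{p-1} max {2^{(m-1)p} R₁^p (2p+d)^p,
R₂^p (2p+d)^p + 2^{(m-1)p} R₁^p σ^{mp} ((m+2)p+d)^{(m+2)p/2}}`. -/
def constH (d : ℕ) (R₁ R₂ : ℝ) (m : ℕ) (σ : ℝ) (p : ℕ) : ℝ :=
  if p = 0 then 1
  else
    (3 : ℝ) ^ (p - 1) *
      max ((2 : ℝ) ^ (((m : ℤ) - 1) * p) * R₁ ^ p * (2 * (p : ℝ) + d) ^ p)
        (R₂ ^ p * (2 * (p : ℝ) + d) ^ p +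
          (2 : ℝ) ^ (((m : ℤ) - 1) * p) * R₁ ^ p * σ ^ (m * p) *
            (((m : ℝ) + 2) * p + d) ^ (((m : ℝ) + 2) * p / 2))

end SPB

end

noncomputable section

namespace SPB

/-! Growth of `f`. By Hahn–Banach the Clarke derivative is the support function of the
subdifferential, so the subgradient bound controls `clarkeDeriv`. A mean value inequality along
segments then gives increments of polynomial size (`IsSPB.abs_sub_le`). This is all that is used of
`f` besides its continuity and lower bound.

Smoothing. Gaussian moments make the expectations converge. Cameron–Martin (`map_add_gauss`) moves a
translation of the argument of `f` onto the Gaussian weight, where it can be differentiated; this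
yields the gradient formula. Integrating increments of `f` against the Gaussian vector gives a
Lipschitz bound for the gradient with weight 𝒜 + ℬ‖x‖^m + 𝒞‖w‖^m, hence the descent inequality
`IsSPB.smoothing_add_le`.

One step. The estimator is unbiased, and its p-th moment is at most ℋ_(p)(‖x‖^(mp) + 1). With q =
‖x‖^m and D = q² + 1, the step size s = τ/D cancels this growth: s²D(𝒜 + ℬq) ≤ τ²(𝒜 + ℬ) and s^(m+2)
D^(m+2) = τ^(m+2). Since D ≤ (q + 1)², the gain s‖∇f_σ‖² is still at least τ‖∇f_σ/(q + 1)‖². This is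
`IsSPB.integral_smoothing_step_le`.

Trajectory. The iterate x^k is independent of u^k, so Fubini turns the one-step bound into one for
expectations. Telescoping, with inf f ≤ f_σ and f_σ(x⁰) ≤ f(x⁰) + ℳ(x⁰)σ, finishes the proof. -/

/-- The Euclidean space `ℝ^d`. -/
abbrev Vec (d : ℕ) : Type := EuclideanSpace ℝ (Fin d)

/-- The standard Gaussian measure on `ℝ^d`. -/
abbrev gauss (d : ℕ) : Measure (Vec d) := stdGaussian (Vec d)

variable {d : ℕ}

/-! ### Gaussian integrals and moments. -/

lemma gauss_eq_map_pi (d : ℕ) :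
    gauss d = (Measure.pi (fun _ : Fin d => gaussianReal 0 1)).map (WithLp.toLp 2) :=
  map_pi_eq_stdGaussian.symm

lemma measurableEmbedding_toLp (d : ℕ) :
    MeasurableEmbedding (WithLp.toLp 2 : (Fin d → ℝ) → Vec d) :=
  (MeasurableEquiv.toLp 2 (Fin d → ℝ)).measurableEmbedding

lemma integrable_exp_mul_sq_gaussianReal {t : ℝ} (ht : t < 1 / 2) :
    Integrable (fun x : ℝ => Real.exp (t * x ^ 2)) (gaussianReal 0 1) := by
  rw [gaussianReal_of_var_ne_zero _ one_ne_zero,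
    integrable_withDensity_iff_integrable_smul₀' (measurable_gaussianPDF 0 1).aemeasurable
      (by simp [gaussianPDF])]
  have h := (integrable_exp_neg_mul_sq (b := 1 / 2 - t) (by linarith)).const_mul (√(2 * Real.pi))⁻¹
  refine h.congr (Eventually.of_forall fun x => ?_)
  simp only [toReal_gaussianPDF, gaussianPDFReal, smul_eq_mul, NNReal.coe_one, mul_one, sub_zero]
  rw [mul_assoc, ← Real.exp_add]
  ring_nf

lemma integral_exp_mul_sq_gaussianReal {t : ℝ} (ht : t < 1 / 2) :
    ∫ x, Real.exp (t * x ^ 2) ∂(gaussianReal 0 1) = √(1 / (1 - 2 * t)) := by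
  rw [integral_gaussianReal_eq_integral_smul one_ne_zero]
  have : ∀ x : ℝ, gaussianPDFReal 0 1 x • Real.exp (t * x ^ 2) =
      (√(2 * Real.pi))⁻¹ * Real.exp (-(1 / 2 - t) * x ^ 2) := by
    intro x
    simp only [gaussianPDFReal, smul_eq_mul, NNReal.coe_one, mul_one, sub_zero]
    rw [mul_assoc, ← Real.exp_add]
    ring_nf
  simp_rw [this]
  rw [integral_const_mul, integral_gaussian, ← Real.sqrt_inv, ← Real.sqrt_mul (by positivity)]
  congr 1
  have : (1 - 2 * t) ≠ 0 := by linarith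
  have : (1 / 2 - t) ≠ 0 := by intro h; apply this; linarith
  field_simp

lemma exp_mul_norm_sq_toLp (t : ℝ) (x : Fin d → ℝ) :
    Real.exp (t * ‖(WithLp.toLp 2 x : Vec d)‖ ^ 2) = ∏ i, Real.exp (t * x i ^ 2) := by
  rw [← Real.exp_sum, ← Finset.mul_sum, EuclideanSpace.real_norm_sq_eq]

lemma integrable_exp_mul_norm_sq {t : ℝ} (ht : t < 1 / 2) :
    Integrable (fun u : Vec d => Real.exp (t * ‖u‖ ^ 2)) (gauss d) := by
  rw [gauss_eq_map_pi, (measurableEmbedding_toLp d).integrable_map_iff]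
  simp only [Function.comp_def, exp_mul_norm_sq_toLp]
  exact Integrable.fintype_prod (f := fun _ : Fin d => fun x : ℝ => Real.exp (t * x ^ 2))
    fun _ => integrable_exp_mul_sq_gaussianReal ht

lemma integral_exp_mul_norm_sq {t : ℝ} (ht : t < 1 / 2) :
    ∫ u, Real.exp (t * ‖u‖ ^ 2) ∂(gauss d) = √(1 / (1 - 2 * t)) ^ d := by
  rw [gauss_eq_map_pi, (measurableEmbedding_toLp d).integral_map]
  simp only [exp_mul_norm_sq_toLp]
  rw [integral_fintype_prod_eq_pow (fun x : ℝ => Real.exp (t * x ^ 2)),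
    integral_exp_mul_sq_gaussianReal ht, Fintype.card_fin]

lemma integrable_exp_mul_norm (c : ℝ) :
    Integrable (fun u : Vec d => Real.exp (c * ‖u‖)) (gauss d) := by
  refine ((integrable_exp_mul_norm_sq (d := d) (t := 1 / 4) (by norm_num)).const_mul
    (Real.exp (c ^ 2))).mono' (by fun_prop) (Eventually.of_forall fun u => ?_)
  rw [Real.norm_of_nonneg (Real.exp_pos _).le, ← Real.exp_add]
  gcongr
  -- Completing the square: c‖u‖ ≤ c² + ‖u‖²/4, and 1/4 is below the threshold 1/2.
  nlinarith [sq_nonneg (c - ‖u‖ / 2)]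

lemma pow_le_factorial_mul_exp {r : ℝ} (hr : 0 ≤ r) (n : ℕ) :
    r ^ n ≤ n.factorial * Real.exp r := by
  have := Real.pow_div_factorial_le_exp r hr n
  rwa [div_le_iff₀ (by positivity), mul_comm] at this

/-- The exponential factor is there to dominate derivatives of the Cameron–Martin weight. -/
lemma integrable_norm_pow_mul_exp (n : ℕ) (c : ℝ) :
    Integrable (fun u : Vec d => ‖u‖ ^ n * Real.exp (c * ‖u‖)) (gauss d) := by
  refine ((integrable_exp_mul_norm (d := d) (1 + c)).const_mul (n.factorial : ℝ)).mono'
    (by fun_prop) (Eventually.of_forall fun u => ?_)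
  rw [Real.norm_of_nonneg (by positivity), add_mul, one_mul, Real.exp_add, ← mul_assoc]
  gcongr
  exact pow_le_factorial_mul_exp (norm_nonneg u) n

lemma integrable_norm_pow (n : ℕ) : Integrable (fun u : Vec d => ‖u‖ ^ n) (gauss d) := by
  simpa using integrable_norm_pow_mul_exp (d := d) n 0

lemma integral_norm_sq (d : ℕ) : ∫ u, ‖u‖ ^ 2 ∂(gauss d) = d := by
  rw [gauss_eq_map_pi, (measurableEmbedding_toLp d).integral_map]
  have hsq : Integrable (fun x : ℝ => x ^ 2) (gaussianReal 0 1) :=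
    IsGaussian.memLp_two_id.integrable_sq
  have h1 : ∫ x : ℝ, x ^ 2 ∂(gaussianReal 0 1) = 1 := by
    have := variance_id_gaussianReal (μ := 0) (v := 1)
    rw [variance_of_integral_eq_zero aemeasurable_id (by simp)] at this
    simpa using this
  simp only [EuclideanSpace.real_norm_sq_eq]
  have hi : ∀ i : Fin d, ∫ x : Fin d → ℝ, x i ^ 2 ∂(Measure.pi fun _ => gaussianReal 0 1) = 1 :=
    fun i => (integral_comp_eval (μ := fun _ : Fin d => gaussianReal 0 1) (i := i)
      hsq.aestronglyMeasurable).trans h1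
  rw [integral_finsetSum (f := fun i (x : Fin d → ℝ) => x i ^ 2) _ fun i _ =>
    integrable_comp_eval (μ := fun _ : Fin d => gaussianReal 0 1) (f := fun x : ℝ => x ^ 2) hsq]
  simp [hi]

/-- Nonnegativity of the variance. The general moment bound at p = 1 would only give √(d + 1), too
weak for the constants. -/
lemma integral_norm_le_sqrt (d : ℕ) : ∫ u, ‖u‖ ∂(gauss d) ≤ √d := by
  have h2 : MemLp (fun u : Vec d => ‖u‖) 2 (gauss d) :=
    (memLp_two_iff_integrable_sq (by fun_prop)).2 (integrable_norm_pow 2)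
  have h := variance_nonneg (fun u : Vec d => ‖u‖) (gauss d)
  rw [variance_eq_sub h2] at h
  apply Real.le_sqrt_of_sq_le
  have := integral_norm_sq d
  simp only [Pi.pow_apply] at h
  linarith

/-- `E‖u‖^p ≤ (p + d)^{p/2}` for a standard Gaussian vector `u`. -/
lemma integral_norm_pow_le (d p : ℕ) :
    ∫ u, ‖u‖ ^ p ∂(gauss d) ≤ ((p : ℝ) + d) ^ ((p : ℝ) / 2) := by
  rcases Nat.eq_zero_or_pos p with rfl | hp
  · simp
  rcases Nat.eq_zero_or_pos d with rfl | hd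
  · have : ∀ u : Vec 0, ‖u‖ ^ p = 0 := fun u => by
      rw [Subsingleton.elim u 0, norm_zero, zero_pow hp.ne']
    simp only [this, integral_zero]
    positivity
  have hp' : (0 : ℝ) < p := by exact_mod_cast hp
  have hd' : (0 : ℝ) < d := by exact_mod_cast hd
  set N : ℝ := p + d with hN
  have hN0 : 0 < N := by positivity
  -- The map r ↦ r^p exp(-t r²) peaks at r² = p/(2t). This t puts the peak at r² = N, with value
  -- N^(p/2) e^(-p/2). The remaining factor E exp(t‖u‖²) = (1 + p/d)^(d/2) is at most e^(p/2).
  set t : ℝ := p / (2 * N) with ht_def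
  have ht : t < 1 / 2 := by
    rw [ht_def, div_lt_div_iff₀ (by positivity) two_pos]
    linarith
  have hpt : ∀ u : Vec d, ‖u‖ ^ p ≤
      N ^ ((p : ℝ) / 2) * Real.exp (-((p : ℝ) / 2)) * Real.exp (t * ‖u‖ ^ 2) := by
    intro u
    rcases (norm_nonneg u).eq_or_lt with h0 | h0
    · rw [← h0, zero_pow hp.ne']
      positivity
    rw [mul_assoc, ← Real.exp_add, Real.rpow_def_of_pos hN0, ← Real.exp_add,
      ← Real.exp_log (pow_pos h0 p), Real.log_pow]
    gcongr
    have hlog := Real.log_le_sub_one_of_pos (show 0 < ‖u‖ ^ 2 / N by positivity)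
    rw [Real.log_div (by positivity) hN0.ne', Real.log_pow] at hlog
    have h1 : t * ‖u‖ ^ 2 = (p : ℝ) / 2 * (‖u‖ ^ 2 / N) := by
      rw [ht_def]; field_simp
    rw [h1]
    push_cast at hlog
    nlinarith
  have hsqrt : √(1 / (1 - 2 * t)) ^ d ≤ Real.exp ((p : ℝ) / 2) := by
    have h1 : 1 / (1 - 2 * t) = N / d := by
      have : 1 - 2 * t = d / N := by
        rw [ht_def]; field_simp; rw [hN]; ring
      rw [this, one_div_div]
    have h2 : √(N / d) ≤ Real.exp ((p : ℝ) / (2 * d)) := by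
      apply Real.sqrt_le_iff.2 ⟨(Real.exp_pos _).le, ?_⟩
      rw [← Real.exp_nat_mul]
      have h3 := Real.add_one_le_exp ((p : ℝ) / d)
      have h4 : N / d = (p : ℝ) / d + 1 := by rw [hN]; field_simp
      rw [h4]
      convert h3 using 2
      push_cast
      field_simp
    rw [h1]
    calc √(N / d) ^ d ≤ Real.exp ((p : ℝ) / (2 * d)) ^ d := by gcongr
      _ = Real.exp ((p : ℝ) / 2) := by
        rw [← Real.exp_nat_mul]
        congr 1
        field_simp
  calc ∫ u, ‖u‖ ^ p ∂(gauss d)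
      ≤ ∫ u, N ^ ((p : ℝ) / 2) * Real.exp (-((p : ℝ) / 2)) * Real.exp (t * ‖u‖ ^ 2) ∂(gauss d) :=
        integral_mono (integrable_norm_pow p) ((integrable_exp_mul_norm_sq ht).const_mul _) hpt
    _ = N ^ ((p : ℝ) / 2) * Real.exp (-((p : ℝ) / 2)) * √(1 / (1 - 2 * t)) ^ d := by
        rw [integral_const_mul, integral_exp_mul_norm_sq ht]
    _ ≤ N ^ ((p : ℝ) / 2) * Real.exp (-((p : ℝ) / 2)) * Real.exp ((p : ℝ) / 2) := by gcongr
    _ = N ^ ((p : ℝ) / 2) := by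
        rw [mul_assoc, ← Real.exp_add, neg_add_cancel, Real.exp_zero, mul_one]

/-! ### Translation of the Gaussian measure. -/

/-- The Cameron–Martin formula: the translate of the standard Gaussian measure by `a`. -/
lemma map_add_gauss (a : Vec d) :
    (gauss d).map (fun u => u + a) =
      (gauss d).withDensity (fun u => ENNReal.ofReal (Real.exp (inner ℝ u a - ‖a‖ ^ 2 / 2))) := by
  have hint : Integrable (fun u : Vec d => Real.exp (inner ℝ u a - ‖a‖ ^ 2 / 2)) (gauss d) := by
    refine (integrable_exp_mul_norm (d := d) ‖a‖).mono' (by fun_prop)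
      (Eventually.of_forall fun u => ?_)
    rw [Real.norm_of_nonneg (Real.exp_pos _).le]
    gcongr
    nlinarith [real_inner_le_norm u a, sq_nonneg ‖a‖]
  have : IsProbabilityMeasure ((gauss d).map (fun u => u + a)) :=
    Measure.isProbabilityMeasure_map (by fun_prop)
  have := isFiniteMeasure_withDensity_ofReal hint.2
  apply Measure.ext_of_charFun
  ext t
  rw [charFun_apply, charFun_apply, integral_map (by fun_prop) (by fun_prop),
    integral_withDensity_eq_integral_toReal_smul (by fun_prop) (by simp)]
  simp only [ENNReal.toReal_ofReal (Real.exp_pos _).le]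
  have hL : ∀ u : Vec d, Complex.exp ((inner ℝ (u + a) t : ℝ) * Complex.I) =
      Complex.exp ((inner ℝ u t : ℝ) * Complex.I) * Complex.exp ((inner ℝ a t : ℝ) * Complex.I) := by
    intro u
    rw [inner_add_left, ← Complex.exp_add]
    push_cast
    ring_nf
  simp_rw [hL]
  rw [integral_mul_const, ← charFun_apply, charFun_stdGaussian]
  -- Weight and character merge into a product of one-dimensional exponentials at a_i + i t_i. Each
  -- integrates to exp((a_i + i t_i)²/2), whose a_i² part the normalising factor cancels.
  have hR : ∀ u : Vec d, Real.exp (inner ℝ u a - ‖a‖ ^ 2 / 2) •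
      Complex.exp ((inner ℝ u t : ℝ) * Complex.I) =
      Complex.exp (-(‖a‖ : ℂ) ^ 2 / 2) * ∏ i, Complex.exp ((a i + t i * Complex.I) * u i) := by
    intro u
    rw [← Complex.exp_sum, ← Complex.exp_add, Complex.real_smul, Complex.ofReal_exp,
      ← Complex.exp_add]
    congr 1
    simp only [PiLp.inner_apply, RCLike.inner_apply, conj_trivial]
    push_cast
    rw [Finset.sum_mul]
    simp_rw [add_mul]
    rw [Finset.sum_add_distrib]
    simp_rw [mul_right_comm _ Complex.I]
    ring
  simp_rw [hR]
  rw [integral_const_mul, gauss_eq_map_pi, (measurableEmbedding_toLp d).integral_map]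
  simp only
  rw [integral_fintype_prod_eq_prod
    (f := fun (i : Fin d) (x : ℝ) => Complex.exp ((a i + t i * Complex.I) * x))]
  have h1 : ∀ z : ℂ, ∫ x : ℝ, Complex.exp (z * x) ∂(gaussianReal 0 1) = Complex.exp (z ^ 2 / 2) := by
    intro z
    have := complexMGF_id_gaussianReal (μ := 0) (v := 1) z
    simpa [complexMGF] using this
  simp_rw [h1]
  rw [← Complex.exp_sum, ← Complex.exp_add, ← Complex.exp_add]
  congr 1
  have hna : (‖a‖ : ℂ) ^ 2 = ∑ i, (a i : ℂ) ^ 2 := by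
    exact_mod_cast congrArg (fun r : ℝ => (r : ℂ)) (EuclideanSpace.real_norm_sq_eq a)
  have hnt : (‖t‖ : ℂ) ^ 2 = ∑ i, (t i : ℂ) ^ 2 := by
    exact_mod_cast congrArg (fun r : ℝ => (r : ℂ)) (EuclideanSpace.real_norm_sq_eq t)
  rw [hna, hnt]
  simp only [PiLp.inner_apply, RCLike.inner_apply, conj_trivial]
  push_cast
  rw [← Finset.sum_neg_distrib, ← Finset.sum_neg_distrib, Finset.sum_div, Finset.sum_div,
    Finset.sum_mul, ← Finset.sum_add_distrib, ← Finset.sum_add_distrib]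
  refine Finset.sum_congr rfl fun i _ => ?_
  have := Complex.I_sq
  linear_combination (-(t i : ℂ) ^ 2 / 2) * this

lemma integral_comp_add_gauss (g : Vec d → ℝ) (hg : Continuous g) (a : Vec d) :
    ∫ u, g (u + a) ∂(gauss d) =
      ∫ u, Real.exp (inner ℝ u a - ‖a‖ ^ 2 / 2) * g u ∂(gauss d) := by
  rw [← integral_map (φ := fun u => u + a) (f := g) (by fun_prop) hg.aestronglyMeasurable,
    map_add_gauss, integral_withDensity_eq_integral_toReal_smul (by fun_prop) (by simp)]
  simp only [ENNReal.toReal_ofReal (Real.exp_pos _).le, smul_eq_mul]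

/-! ### Clarke derivative and growth of `f`. -/

/-- The difference quotient whose upper limit is the Clarke directional derivative. -/
def diffQuot (f : Vec d → ℝ) (v : Vec d) (p : Vec d × ℝ) : ℝ :=
  (f (p.1 + p.2 • v) - f p.1) / p.2

lemma tendsto_add_smul_clarke (x v : Vec d) :
    Tendsto (fun p : Vec d × ℝ => (p.1 + p.2 • v, p.2)) (𝓝 x ×ˢ 𝓝[>] (0 : ℝ))
      (𝓝 x ×ˢ 𝓝[>] (0 : ℝ)) := by
  refine Tendsto.prodMk ?_ tendsto_snd
  have h1 : Tendsto (fun p : Vec d × ℝ => p.1) (𝓝 x ×ˢ 𝓝[>] (0 : ℝ)) (𝓝 x) := tendsto_fst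
  have h2 : Tendsto (fun p : Vec d × ℝ => p.2) (𝓝 x ×ˢ 𝓝[>] (0 : ℝ)) (𝓝 0) :=
    tendsto_snd.mono_right nhdsWithin_le_nhds
  simpa using h1.add (h2.smul_const v)

lemma tendsto_mul_clarke (x : Vec d) {c : ℝ} (hc : 0 < c) :
    Tendsto (fun p : Vec d × ℝ => (p.1, c * p.2)) (𝓝 x ×ˢ 𝓝[>] (0 : ℝ))
      (𝓝 x ×ˢ 𝓝[>] (0 : ℝ)) := by
  refine Tendsto.prodMk tendsto_fst ?_
  have h : Tendsto (fun t : ℝ => c * t) (𝓝[>] 0) (𝓝[>] 0) := by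
    refine tendsto_nhdsWithin_iff.2 ⟨?_, ?_⟩
    · simpa using ((continuous_const_mul c).tendsto 0).mono_left nhdsWithin_le_nhds
    · filter_upwards [self_mem_nhdsWithin] with t ht using mul_pos hc ht
  exact h.comp tendsto_snd

lemma eventually_pos_clarke (x : Vec d) : ∀ᶠ p in 𝓝 x ×ˢ 𝓝[>] (0 : ℝ), 0 < p.2 :=
  tendsto_snd.eventually (self_mem_nhdsWithin)

/-- Boundedness makes the real `limsup` in `clarkeDeriv` a genuine upper limit rather than a default
value. -/
lemma exists_abs_diffQuot_le {f : Vec d → ℝ} (hf : LocallyLipschitz f) (x v : Vec d) :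
    ∃ K : ℝ, ∀ᶠ p in 𝓝 x ×ˢ 𝓝[>] (0 : ℝ), |diffQuot f v p| ≤ K := by
  obtain ⟨K, s, hs, hK⟩ := hf x
  refine ⟨K * ‖v‖, ?_⟩
  have h1 : ∀ᶠ p in 𝓝 x ×ˢ 𝓝[>] (0 : ℝ), p.1 ∈ s := tendsto_fst.eventually hs
  have h2 : ∀ᶠ p in 𝓝 x ×ˢ 𝓝[>] (0 : ℝ), p.1 + p.2 • v ∈ s :=
    (tendsto_add_smul_clarke x v).eventually h1
  filter_upwards [h1, h2, eventually_pos_clarke x] with p hp1 hp2 hp3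
  rw [diffQuot, abs_div, abs_of_pos hp3, div_le_iff₀ hp3]
  have := hK.dist_le_mul _ hp2 _ hp1
  rw [Real.dist_eq, dist_eq_norm, add_sub_cancel_left, norm_smul, Real.norm_of_nonneg hp3.le] at this
  linarith

lemma isBoundedUnder_diffQuot {f : Vec d → ℝ} (hf : LocallyLipschitz f) (x v : Vec d) :
    IsBoundedUnder (· ≤ ·) (𝓝 x ×ˢ 𝓝[>] (0 : ℝ)) (diffQuot f v) :=
  let ⟨K, hK⟩ := exists_abs_diffQuot_le hf x v
  ⟨K, eventually_map.2 (hK.mono fun _ hp => (abs_le.1 hp).2)⟩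

lemma isCoboundedUnder_diffQuot {f : Vec d → ℝ} (hf : LocallyLipschitz f) (x v : Vec d) :
    IsCoboundedUnder (· ≤ ·) (𝓝 x ×ˢ 𝓝[>] (0 : ℝ)) (diffQuot f v) :=
  let ⟨K, hK⟩ := exists_abs_diffQuot_le hf x v
  IsBoundedUnder.isCoboundedUnder_le
    ⟨-K, eventually_map.2 (hK.mono fun _ hp => (abs_le.1 hp).1)⟩

lemma eventually_diffQuot_lt {f : Vec d → ℝ} (hf : LocallyLipschitz f) {x v : Vec d} {r : ℝ}
    (hr : clarkeDeriv f x v < r) : ∀ᶠ p in 𝓝 x ×ˢ 𝓝[>] (0 : ℝ), diffQuot f v p < r :=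
  eventually_lt_of_limsup_lt hr (isBoundedUnder_diffQuot hf x v)

lemma clarkeDeriv_le {f : Vec d → ℝ} (hf : LocallyLipschitz f) {x v : Vec d} {r : ℝ}
    (hr : ∀ᶠ p in 𝓝 x ×ˢ 𝓝[>] (0 : ℝ), diffQuot f v p ≤ r) : clarkeDeriv f x v ≤ r :=
  limsup_le_of_le (isCoboundedUnder_diffQuot hf x v) hr

lemma clarkeDeriv_zero (f : Vec d → ℝ) (x : Vec d) : clarkeDeriv f x 0 = 0 := by
  simp [clarkeDeriv]

/-- The quotient along v + w at x' is the one along v at x' plus the one along w at x' + tv. The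
upper limit also runs over base points, so the moved base point is harmless. -/
lemma clarkeDeriv_add_le {f : Vec d → ℝ} (hf : LocallyLipschitz f) (x v w : Vec d) :
    clarkeDeriv f x (v + w) ≤ clarkeDeriv f x v + clarkeDeriv f x w := by
  refine le_of_forall_pos_le_add fun ε hε => ?_
  have hv := eventually_diffQuot_lt hf (show clarkeDeriv f x v < clarkeDeriv f x v + ε / 2 by linarith)
  have hw := (tendsto_add_smul_clarke x v).eventually
    (eventually_diffQuot_lt hf (show clarkeDeriv f x w < clarkeDeriv f x w + ε / 2 by linarith))
  refine clarkeDeriv_le hf ?_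
  filter_upwards [hv, hw] with p h1 h2
  have : diffQuot f (v + w) p = diffQuot f v p + diffQuot f w (p.1 + p.2 • v, p.2) := by
    simp only [diffQuot]
    rw [← add_div, smul_add, ← add_assoc]
    ring
  linarith

lemma clarkeDeriv_smul_le {f : Vec d → ℝ} (hf : LocallyLipschitz f) (x v : Vec d) {c : ℝ}
    (hc : 0 < c) : clarkeDeriv f x (c • v) ≤ c * clarkeDeriv f x v := by
  refine le_of_forall_pos_le_add fun ε hε => ?_
  have hv := (tendsto_mul_clarke x hc).eventually
    (eventually_diffQuot_lt hf
      (show clarkeDeriv f x v < clarkeDeriv f x v + ε / c from lt_add_of_pos_right _ (by positivity)))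
  refine clarkeDeriv_le hf ?_
  filter_upwards [hv, eventually_pos_clarke x] with p h1 h2
  have h3 : diffQuot f (c • v) p = c * diffQuot f v (p.1, c * p.2) := by
    simp only [diffQuot]
    rw [smul_smul, mul_comm p.2 c]
    field_simp
  rw [h3]
  calc c * diffQuot f v (p.1, c * p.2) ≤ c * (clarkeDeriv f x v + ε / c) := by gcongr
    _ = c * clarkeDeriv f x v + ε := by field_simp

lemma clarkeDeriv_smul {f : Vec d → ℝ} (hf : LocallyLipschitz f) (x v : Vec d) {c : ℝ}
    (hc : 0 < c) : clarkeDeriv f x (c • v) = c * clarkeDeriv f x v := by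
  refine le_antisymm (clarkeDeriv_smul_le hf x v hc) ?_
  have h := clarkeDeriv_smul_le hf x (c • v) (inv_pos.2 hc)
  rw [smul_smul, inv_mul_cancel₀ hc.ne', one_smul] at h
  calc c * clarkeDeriv f x v ≤ c * (c⁻¹ * clarkeDeriv f x (c • v)) := by gcongr
    _ = clarkeDeriv f x (c • v) := by field_simp

/-- The Clarke directional derivative is the support function of the subdifferential: every
direction is attained by some subgradient. -/
lemma exists_mem_clarkeSubdiff_inner_eq {f : Vec d → ℝ} (hf : LocallyLipschitz f) (x : Vec d)
    {v : Vec d} (hv : v ≠ 0) : ∃ ζ ∈ clarkeSubdiff f x, inner ℝ ζ v = clarkeDeriv f x v := by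
  -- Hahn–Banach: extend cv ↦ c f°(x; v) from the line through v, staying below the sublinear
  -- function f°(x; ·). For c < 0, domination on the line follows from 0 ≤ f°(x; cv) + f°(x; -cv).
  obtain ⟨g, hg1, hg2⟩ := exists_extension_of_le_sublinear
    (LinearPMap.mkSpanSingleton v (clarkeDeriv f x v) hv) (clarkeDeriv f x)
    (fun c hc w => clarkeDeriv_smul hf x w hc) (clarkeDeriv_add_le hf x) (by
      rintro ⟨w, hw⟩
      obtain ⟨c, rfl⟩ := Submodule.mem_span_singleton.1 hw
      rw [LinearPMap.mkSpanSingleton'_apply, RingHom.id_apply, smul_eq_mul]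
      rcases lt_trichotomy c 0 with hc | rfl | hc
      · have h1 := clarkeDeriv_add_le hf x (c • v) ((-c) • v)
        rw [← add_smul, add_neg_cancel, zero_smul, clarkeDeriv_zero,
          clarkeDeriv_smul hf x v (neg_pos.2 hc)] at h1
        simp only
        linarith
      · simp [clarkeDeriv_zero]
      · simp only
        exact (clarkeDeriv_smul hf x v hc).ge)
  have hζ : ∀ w, inner ℝ ((InnerProductSpace.toDual ℝ (Vec d)).symm
      (LinearMap.toContinuousLinearMap g)) w = g w := fun w => by
    rw [InnerProductSpace.toDual_symm_apply]
    rfl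
  refine ⟨_, fun w => (hζ w).trans_le (hg2 w), ?_⟩
  rw [hζ]
  have := hg1 ⟨v, Submodule.mem_span_singleton_self v⟩
  simpa using this.trans (LinearPMap.mkSpanSingleton_apply ℝ ℝ hv _)

lemma IsSPB.clarkeDeriv_le_mul_norm {f : Vec d → ℝ} {R₁ R₂ : ℝ} {m : ℕ} (hf : IsSPB f R₁ R₂ m)
    (x v : Vec d) : clarkeDeriv f x v ≤ (R₁ * ‖x‖ ^ m + R₂) * ‖v‖ := by
  rcases eq_or_ne v 0 with rfl | hv
  · simp [clarkeDeriv_zero]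
  obtain ⟨ζ, hζ, h⟩ := exists_mem_clarkeSubdiff_inner_eq hf.locallyLipschitz x hv
  rw [← h]
  exact (real_inner_le_norm ζ v).trans (by gcongr; exact hf.norm_le x ζ hζ)

/-- Mean value inequality: a bound on the Clarke subgradients on a segment bounds the increment. -/
lemma IsSPB.sub_le_of_segment {f : Vec d → ℝ} {R₁ R₂ : ℝ} {m : ℕ} (hf : IsSPB f R₁ R₂ m)
    (x w : Vec d) {M : ℝ} (hM : ∀ t ∈ Set.Icc (0 : ℝ) 1, R₁ * ‖x + t • w‖ ^ m + R₂ ≤ M) :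
    f (x + w) - f x ≤ M * ‖w‖ := by
  -- Along the segment `f` need not be differentiable; the comparison theorem only needs right
  -- slopes to be frequently below any r > M‖w‖, which the Clarke bound supplies.
  have key := image_le_of_liminf_slope_right_le_deriv_boundary (f := fun t : ℝ => f (x + t • w))
    (a := 0) (b := 1) (B := fun t => f x + t * (M * ‖w‖)) (B' := fun _ => M * ‖w‖)
    (by have := hf.locallyLipschitz.continuous; fun_prop) (by simp) (by fun_prop)
    (fun t _ => by
      simpa using (((hasDerivAt_id t).mul_const (M * ‖w‖)).const_add (f x)).hasDerivWithinAt)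
    (fun t ht r hr => by
      have h1 : clarkeDeriv f (x + t • w) w < r :=
        ((hf.clarkeDeriv_le_mul_norm _ _).trans
          (by gcongr; exact hM t ⟨ht.1, ht.2.le⟩)).trans_lt hr
      have h2 : Tendsto (fun z : ℝ => (x + t • w, z - t)) (𝓝[>] t)
          (𝓝 (x + t • w) ×ˢ 𝓝[>] (0 : ℝ)) := by
        refine tendsto_const_nhds.prodMk (tendsto_nhdsWithin_iff.2 ⟨?_, ?_⟩)
        · have : Tendsto (fun z : ℝ => z - t) (𝓝 t) (𝓝 (t - t)) :=
            (continuous_sub_right t).tendsto t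
          rw [sub_self] at this
          exact this.mono_left nhdsWithin_le_nhds
        · filter_upwards [self_mem_nhdsWithin] with z hz using sub_pos.2 (Set.mem_Ioi.1 hz)
      refine ((h2.eventually (eventually_diffQuot_lt hf.locallyLipschitz h1)).mono
        fun z hz => ?_).frequently
      rw [slope_def_field]
      have h3 : x + t • w + (z - t) • w = x + z • w := by
        rw [add_assoc, ← add_smul, add_sub_cancel]
      simpa only [diffQuot, h3] using hz)
  have := key (x := 1) ⟨zero_le_one, le_rfl⟩
  simp only [one_smul, one_mul] at this
  linarith

/-- Convexity of the power. The integer exponent covers m = 0 as well, where the factor 1/2 meets 1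
+ 1. -/
lemma add_pow_le_zpow_mul {a b : ℝ} (ha : 0 ≤ a) (hb : 0 ≤ b) (m : ℕ) :
    (a + b) ^ m ≤ (2 : ℝ) ^ ((m : ℤ) - 1) * (a ^ m + b ^ m) := by
  rcases m with _ | m
  · norm_num
  · have h := add_pow_le ha hb (m + 1)
    simpa using h

lemma IsSPB.abs_sub_le {f : Vec d → ℝ} {R₁ R₂ : ℝ} {m : ℕ} (hf : IsSPB f R₁ R₂ m)
    (x w : Vec d) : |f (x + w) - f x| ≤
      ((2 : ℝ) ^ ((m : ℤ) - 1) * R₁ * (‖x‖ ^ m + ‖w‖ ^ m) + R₂) * ‖w‖ := by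
  have hR := hf.R₁_nonneg
  have hb : ∀ t ∈ Set.Icc (0 : ℝ) 1, R₁ * ‖x + t • w‖ ^ m + R₂ ≤
      (2 : ℝ) ^ ((m : ℤ) - 1) * R₁ * (‖x‖ ^ m + ‖w‖ ^ m) + R₂ := by
    intro t ht
    have h1 : ‖x + t • w‖ ≤ ‖x‖ + ‖w‖ := by
      refine (norm_add_le _ _).trans ?_
      rw [norm_smul, Real.norm_of_nonneg ht.1]
      gcongr
      exact mul_le_of_le_one_left (norm_nonneg w) ht.2
    calc R₁ * ‖x + t • w‖ ^ m + R₂ ≤ R₁ * (‖x‖ + ‖w‖) ^ m + R₂ := by gcongr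
      _ ≤ R₁ * ((2 : ℝ) ^ ((m : ℤ) - 1) * (‖x‖ ^ m + ‖w‖ ^ m)) + R₂ := by
          gcongr
          exact add_pow_le_zpow_mul (norm_nonneg x) (norm_nonneg w) m
      _ = _ := by ring
  refine abs_sub_le_iff.2 ⟨hf.sub_le_of_segment x w hb, ?_⟩
  -- The other sign: the same segment run backwards.
  have h := hf.sub_le_of_segment (x + w) (-w) (fun t ht => by
    have : x + w + t • (-w) = x + (1 - t) • w := by
      rw [sub_smul, one_smul, smul_neg]; abel
    rw [this]
    exact hb (1 - t) ⟨by linarith [ht.2], by linarith [ht.1]⟩)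
  simpa using h

/-! ### The smoothing and its gradient. -/

variable {f : Vec d → ℝ} {R₁ R₂ σ : ℝ} {m : ℕ}

/-- The Gaussian formula `σ⁻¹ E[f (y + σ v) v]` for the gradient of the smoothing. -/
def smoothingGrad (f : Vec d → ℝ) (σ : ℝ) (y : Vec d) : Vec d :=
  σ⁻¹ • ∫ v, f (y + σ • v) • v ∂(gauss d)

lemma IsSPB.continuous (hf : IsSPB f R₁ R₂ m) : Continuous f := hf.locallyLipschitz.continuous

lemma IsSPB.abs_sub_smul_le (hf : IsSPB f R₁ R₂ m) (hσ : 0 < σ) (y u : Vec d) :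
    |f (y + σ • u) - f y| ≤
      σ * (((2 : ℝ) ^ ((m : ℤ) - 1) * R₁ * ‖y‖ ^ m + R₂) * ‖u‖ +
        (2 : ℝ) ^ ((m : ℤ) - 1) * R₁ * σ ^ m * ‖u‖ ^ (m + 1)) := by
  refine (hf.abs_sub_le y (σ • u)).trans_eq ?_
  rw [norm_smul, Real.norm_of_nonneg hσ.le]
  ring

/-- One statement for three uses, as (k, c): (0, 0) for the smoothing, (1, 0) for the gradient
formula, (1, 1) for differentiation under the integral. -/
lemma IsSPB.integrable_mul_norm_pow_mul_exp (hf : IsSPB f R₁ R₂ m) (hσ : 0 < σ) (y : Vec d)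
    (k : ℕ) (c : ℝ) :
    Integrable (fun u => f (y + σ • u) * (‖u‖ ^ k * Real.exp (c * ‖u‖))) (gauss d) := by
  set a := (2 : ℝ) ^ ((m : ℤ) - 1) * R₁
  have hcont := hf.continuous
  refine ((((integrable_norm_pow_mul_exp (d := d) k c).const_mul |f y|).add
    ((integrable_norm_pow_mul_exp (d := d) (k + 1) c).const_mul (σ * (a * ‖y‖ ^ m + R₂)))).add
    ((integrable_norm_pow_mul_exp (d := d) (k + (m + 1)) c).const_mul (σ * (a * σ ^ m)))).mono'
    (by fun_prop) (Eventually.of_forall fun u => ?_)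
  have h := hf.abs_sub_smul_le hσ y u
  have h2 : |f (y + σ • u)| ≤ |f y| + |f (y + σ • u) - f y| := by
    have := abs_add_le (f y) (f (y + σ • u) - f y)
    rwa [add_sub_cancel] at this
  rw [norm_mul, Real.norm_of_nonneg (show 0 ≤ ‖u‖ ^ k * Real.exp (c * ‖u‖) by positivity),
    Real.norm_eq_abs]
  calc |f (y + σ • u)| * (‖u‖ ^ k * Real.exp (c * ‖u‖))
      ≤ (|f y| + σ * ((a * ‖y‖ ^ m + R₂) * ‖u‖ + a * σ ^ m * ‖u‖ ^ (m + 1))) *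
        (‖u‖ ^ k * Real.exp (c * ‖u‖)) := by
        gcongr
        linarith
    _ = _ := by
        simp only [Pi.add_apply]
        ring

lemma IsSPB.integrable_comp (hf : IsSPB f R₁ R₂ m) (hσ : 0 < σ) (y : Vec d) :
    Integrable (fun u => f (y + σ • u)) (gauss d) := by
  simpa using hf.integrable_mul_norm_pow_mul_exp hσ y 0 0

lemma IsSPB.integrable_comp_smul (hf : IsSPB f R₁ R₂ m) (hσ : 0 < σ) (y : Vec d) :
    Integrable (fun u => f (y + σ • u) • u) (gauss d) := by
  have hcont := hf.continuous
  refine (hf.integrable_mul_norm_pow_mul_exp hσ y 1 0).mono (by fun_prop)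
    (Eventually.of_forall fun u => ?_)
  simp [norm_smul]

/-- On the right, h enters only through smooth weights, so differentiating in h requires no
derivative of `f`. -/
lemma IsSPB.smoothing_add_smul (hf : IsSPB f R₁ R₂ m) (y h : Vec d) :
    smoothing f σ (y + σ • h) =
      Real.exp (-(‖h‖ ^ 2 / 2)) * ∫ u, Real.exp (inner ℝ u h) * f (y + σ • u) ∂(gauss d) := by
  have hcont := hf.continuous
  have := integral_comp_add_gauss (fun u => f (y + σ • u)) (by fun_prop) h
  rw [smoothing, ← integral_const_mul]
  simp_rw [← mul_assoc, ← Real.exp_add, neg_add_eq_sub]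
  rw [← this]
  simp_rw [smul_add, add_assoc, add_comm (σ • h)]

lemma IsSPB.hasFDerivAt_integral_exp_inner (hf : IsSPB f R₁ R₂ m) (hσ : 0 < σ) (y : Vec d) :
    HasFDerivAt (fun h => ∫ u, Real.exp (inner ℝ u h) * f (y + σ • u) ∂(gauss d))
      (innerSL ℝ (∫ u, f (y + σ • u) • u ∂(gauss d))) 0 := by
  have hcont := hf.continuous
  have hle : ∀ u h : Vec d, h ∈ Metric.ball (0 : Vec d) 1 → inner ℝ u h ≤ 1 * ‖u‖ := by
    intro u h hh
    have hh' : ‖h‖ < 1 := by simpa using hh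
    have := real_inner_le_norm u h
    nlinarith [norm_nonneg u]
  have key := hasFDerivAt_integral_of_dominated_of_fderiv_le (μ := gauss d)
    (F := fun h u => Real.exp (inner ℝ u h) * f (y + σ • u))
    (F' := fun h u => (Real.exp (inner ℝ u h) * f (y + σ • u)) • innerSL ℝ u)
    (x₀ := (0 : Vec d)) (s := Metric.ball 0 1)
    -- For h in the unit ball, ⟨u, h⟩ ≤ ‖u‖; differentiation brings down one more factor ‖u‖.
    (bound := fun u => |f (y + σ • u) * (‖u‖ ^ 1 * Real.exp (1 * ‖u‖))|)
    (Metric.ball_mem_nhds _ one_pos)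
    (Eventually.of_forall fun h => by fun_prop)
    (by simpa using hf.integrable_comp hσ y)
    (by fun_prop)
    (Eventually.of_forall fun u h hh => by
      rw [norm_smul, innerSL_apply_norm, norm_mul, Real.norm_of_nonneg (Real.exp_pos _).le,
        abs_mul, abs_of_nonneg (show 0 ≤ ‖u‖ ^ 1 * Real.exp (1 * ‖u‖) by positivity), pow_one,
        Real.norm_eq_abs]
      have := Real.exp_le_exp.2 (hle u h hh)
      calc Real.exp (inner ℝ u h) * |f (y + σ • u)| * ‖u‖
          ≤ Real.exp (1 * ‖u‖) * |f (y + σ • u)| * ‖u‖ := by gcongr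
        _ = _ := by ring)
    (hf.integrable_mul_norm_pow_mul_exp hσ y 1 1).abs
    (Eventually.of_forall fun u h _ => by
      have h1 : HasFDerivAt (fun h : Vec d => inner ℝ u h) (innerSL ℝ u) h :=
        (innerSL ℝ u).hasFDerivAt
      have h2 := h1.exp.mul_const (f (y + σ • u))
      refine h2.congr_fderiv ?_
      rw [smul_smul, mul_comm])
  refine key.congr_fderiv ?_
  rw [← ContinuousLinearMap.integral_comp_comm _ (hf.integrable_comp_smul hσ y)]
  refine integral_congr_ae (Eventually.of_forall fun u => ?_)
  simp

/-- The Gaussian smoothing is differentiable and its gradient is `σ⁻¹ E[f (y + σ v) v]`. -/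
lemma IsSPB.hasGradientAt_smoothing (hf : IsSPB f R₁ R₂ m) (hσ : 0 < σ) (y : Vec d) :
    HasGradientAt (smoothing f σ) (smoothingGrad f σ y) y := by
  set G : Vec d → ℝ := fun h => Real.exp (-(‖h‖ ^ 2 / 2)) *
    ∫ u, Real.exp (inner ℝ u h) * f (y + σ • u) ∂(gauss d) with hG
  -- The Gaussian prefactor is stationary at h = 0 with value 1, so only the integral contributes to
  -- the derivative.
  have h1 : HasFDerivAt (fun h : Vec d => Real.exp (-(‖h‖ ^ 2 / 2))) (0 : Vec d →L[ℝ] ℝ) 0 := by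
    have h := (((hasStrictFDerivAt_norm_sq (0 : Vec d)).hasFDerivAt).const_mul (-(1 / 2))).exp
    refine (h.congr_fderiv (by ext; simp)).congr_of_eventuallyEq (Eventually.of_forall fun z => ?_)
    ring_nf
  have h2 : HasFDerivAt G (innerSL ℝ (∫ u, f (y + σ • u) • u ∂(gauss d))) 0 :=
    (h1.mul (hf.hasFDerivAt_integral_exp_inner hσ y)).congr_fderiv (by ext; simp)
  have h3 : HasFDerivAt (fun z : Vec d => σ⁻¹ • (z - y)) (σ⁻¹ • ContinuousLinearMap.id ℝ (Vec d)) y :=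
    ((hasFDerivAt_id y).sub_const y).const_smul σ⁻¹
  have h4 : smoothing f σ = fun z => G (σ⁻¹ • (z - y)) := by
    ext z
    rw [hG]
    simp only
    rw [← hf.smoothing_add_smul, smul_smul, mul_inv_cancel₀ hσ.ne', one_smul, add_sub_cancel]
  rw [hasGradientAt_iff_hasFDerivAt, h4]
  have h5 : HasFDerivAt G (innerSL ℝ (∫ u, f (y + σ • u) • u ∂(gauss d))) (σ⁻¹ • (y - y)) := by
    simpa using h2
  refine (h5.comp y h3).congr_fderiv ?_
  ext z
  simp [smoothingGrad]

lemma IsSPB.continuous_smoothing (hf : IsSPB f R₁ R₂ m) (hσ : 0 < σ) :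
    Continuous (smoothing f σ) :=
  continuous_iff_continuousAt.2 fun y => (hf.hasGradientAt_smoothing hσ y).continuousAt

lemma IsSPB.gradient_smoothing (hf : IsSPB f R₁ R₂ m) (hσ : 0 < σ) (y : Vec d) :
    gradient (smoothing f σ) y = smoothingGrad f σ y :=
  (hf.hasGradientAt_smoothing hσ y).gradient

lemma IsSPB.measurable_smoothingGrad (hf : IsSPB f R₁ R₂ m) (hσ : 0 < σ) :
    Measurable (smoothingGrad f σ) := by
  have h : smoothingGrad f σ = fun y =>
      (InnerProductSpace.toDual ℝ (Vec d)).symm (fderiv ℝ (smoothing f σ) y) := by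
    ext1 y
    rw [← hf.gradient_smoothing hσ y]
    rfl
  rw [h]
  exact ((InnerProductSpace.toDual ℝ (Vec d)).symm.continuous.measurable).comp
    (measurable_fderiv ℝ _)

/-! ### Weighted smoothness, descent inequality and approximation error. -/

lemma zpow_two_mul_sub_two (m : ℕ) :
    (2 : ℝ) ^ (2 * (m : ℤ) - 2) = (2 : ℝ) ^ ((m : ℤ) - 1) * (2 : ℝ) ^ ((m : ℤ) - 1) := by
  rw [← zpow_add₀ two_ne_zero]
  ring_nf

lemma constA_eq (d : ℕ) (R₁ R₂ : ℝ) (m : ℕ) (hσ : 0 < σ) :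
    constA d R₁ R₂ m σ = σ⁻¹ * ((2 : ℝ) ^ ((m : ℤ) - 1) * R₁ * (2 : ℝ) ^ ((m : ℤ) - 1) * σ ^ m *
      ((m : ℝ) + 1 + d) ^ (((m : ℝ) + 1) / 2) + R₂ * √d) := by
  rw [constA, zpow_two_mul_sub_two, zpow_sub_one₀ hσ.ne', zpow_natCast]
  ring

lemma integral_norm_pow_succ_le (d m : ℕ) :
    ∫ u, ‖u‖ ^ (m + 1) ∂(gauss d) ≤ ((m : ℝ) + 1 + d) ^ (((m : ℝ) + 1) / 2) := by
  simpa using integral_norm_pow_le d (m + 1)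

lemma integrable_affine_norm_add_norm_pow (b c : ℝ) (n : ℕ) :
    Integrable (fun v : Vec d => b * ‖v‖ + c * ‖v‖ ^ n) (gauss d) :=
  (by simpa using (integrable_norm_pow (d := d) 1).const_mul b :
    Integrable (fun v : Vec d => b * ‖v‖) (gauss d)).add ((integrable_norm_pow n).const_mul c)

lemma integral_affine_norm_add_norm_pow_le {b c : ℝ} (hb : 0 ≤ b) (hc : 0 ≤ c) (m : ℕ) :
    ∫ v : Vec d, (b * ‖v‖ + c * ‖v‖ ^ (m + 1)) ∂(gauss d) ≤
      b * √d + c * ((m : ℝ) + 1 + d) ^ (((m : ℝ) + 1) / 2) := by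
  rw [integral_add (by simpa using (integrable_norm_pow (d := d) 1).const_mul b)
    ((integrable_norm_pow (m + 1)).const_mul c), integral_const_mul, integral_const_mul]
  gcongr
  · exact integral_norm_le_sqrt d
  · exact integral_norm_pow_succ_le d m

/-- Polynomially weighted Lipschitz estimate for the gradient of the smoothing. -/
lemma IsSPB.norm_smoothingGrad_sub_le (hf : IsSPB f R₁ R₂ m) (hσ : 0 < σ) (x w : Vec d) :
    ‖smoothingGrad f σ (x + w) - smoothingGrad f σ x‖ ≤
      (constA d R₁ R₂ m σ + constB d R₁ m σ * ‖x‖ ^ m + constC d R₁ m σ * ‖w‖ ^ m) * ‖w‖ := by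
  have hR₁ := hf.R₁_nonneg
  have hR₂ := hf.R₂_pos.le
  set b := (2 : ℝ) ^ ((m : ℤ) - 1) with hb
  have hb0 : 0 < b := by positivity
  rw [smoothingGrad, smoothingGrad, ← smul_sub,
    ← integral_sub (hf.integrable_comp_smul hσ _) (hf.integrable_comp_smul hσ _), norm_smul,
    Real.norm_of_nonneg (inv_pos.2 hσ).le]
  -- The increment bound is used at base point x + σv with displacement w. Splitting ‖x + σv‖^m
  -- costs a second factor 2^(m-1), whence 2^(2m-2) in 𝒜 and ℬ but 2^(m-1) in 𝒞.
  have hpt : ∀ v : Vec d, ‖f (x + w + σ • v) • v - f (x + σ • v) • v‖ ≤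
      ((b * R₁ * b * ‖x‖ ^ m + b * R₁ * ‖w‖ ^ m + R₂) * ‖w‖) * ‖v‖ +
        (b * R₁ * b * σ ^ m * ‖w‖) * ‖v‖ ^ (m + 1) := by
    intro v
    rw [← sub_smul, norm_smul, Real.norm_eq_abs]
    have h1 := hf.abs_sub_le (x + σ • v) w
    have h2 : ‖x + σ • v‖ ^ m ≤ b * (‖x‖ ^ m + σ ^ m * ‖v‖ ^ m) := by
      have h3 : ‖x + σ • v‖ ≤ ‖x‖ + σ * ‖v‖ := by
        refine (norm_add_le _ _).trans_eq ?_
        rw [norm_smul, Real.norm_of_nonneg hσ.le]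
      rw [← mul_pow]
      exact (pow_le_pow_left₀ (norm_nonneg _) h3 m).trans
        (add_pow_le_zpow_mul (norm_nonneg x) (by positivity) m)
    rw [show x + w + σ • v = x + σ • v + w by abel]
    calc |f (x + σ • v + w) - f (x + σ • v)| * ‖v‖
        ≤ ((b * R₁ * (‖x + σ • v‖ ^ m + ‖w‖ ^ m) + R₂) * ‖w‖) * ‖v‖ := by gcongr
      _ ≤ ((b * R₁ * (b * (‖x‖ ^ m + σ ^ m * ‖v‖ ^ m) + ‖w‖ ^ m) + R₂) * ‖w‖) * ‖v‖ := by gcongr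
      _ = _ := by ring
  have h := (norm_integral_le_of_norm_le (integrable_affine_norm_add_norm_pow _ _ _)
    (Eventually.of_forall hpt)).trans
    (integral_affine_norm_add_norm_pow_le (by positivity) (by positivity) m)
  calc σ⁻¹ * ‖∫ v, (f (x + w + σ • v) • v - f (x + σ • v) • v) ∂(gauss d)‖
      ≤ σ⁻¹ * (((b * R₁ * b * ‖x‖ ^ m + b * R₁ * ‖w‖ ^ m + R₂) * ‖w‖) * √d +
        (b * R₁ * b * σ ^ m * ‖w‖) * ((m : ℝ) + 1 + d) ^ (((m : ℝ) + 1) / 2)) := by gcongr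
    _ = _ := by
      rw [constA_eq d R₁ R₂ m hσ, constB, constC, zpow_two_mul_sub_two, ← hb]
      ring

lemma constA_nonneg (hf : IsSPB f R₁ R₂ m) (hσ : 0 < σ) : 0 ≤ constA d R₁ R₂ m σ := by
  have := hf.R₁_nonneg
  have := hf.R₂_pos
  rw [constA]
  positivity

lemma constB_nonneg (hf : IsSPB f R₁ R₂ m) (hσ : 0 < σ) : 0 ≤ constB d R₁ m σ := by
  have := hf.R₁_nonneg
  rw [constB]
  positivity

lemma constC_nonneg (hf : IsSPB f R₁ R₂ m) (hσ : 0 < σ) : 0 ≤ constC d R₁ m σ := by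
  have := hf.R₁_nonneg
  rw [constC]
  positivity

/-- Descent inequality for the smoothing. -/
lemma IsSPB.smoothing_add_le (hf : IsSPB f R₁ R₂ m) (hσ : 0 < σ) (x w : Vec d) :
    smoothing f σ (x + w) ≤ smoothing f σ x + inner ℝ (smoothingGrad f σ x) w +
      (constA d R₁ R₂ m σ + constB d R₁ m σ * ‖x‖ ^ m) / 2 * ‖w‖ ^ 2 +
      constC d R₁ m σ / ((m : ℝ) + 2) * ‖w‖ ^ (m + 2) := by
  set A := constA d R₁ R₂ m σ + constB d R₁ m σ * ‖x‖ ^ m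
  set C := constC d R₁ m σ
  have hm : (m : ℝ) + 2 ≠ 0 := by positivity
  have hline : ∀ t : ℝ, HasDerivAt (fun t : ℝ => smoothing f σ (x + t • w))
      (inner ℝ (smoothingGrad f σ (x + t • w)) w) t := by
    intro t
    have h1 : HasDerivAt (fun t : ℝ => x + t • w) w t := by
      simpa using ((hasDerivAt_id t).smul_const w).const_add x
    have h2 := (hf.hasGradientAt_smoothing hσ (x + t • w)).hasFDerivAt.comp_hasDerivAt t h1
    exact h2.congr_deriv (by simp)
  -- The majorant is the antiderivative of the gradient bound along the segment; integrating t and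
  -- t^(m+1) produces the factors 1/2 and 1/(m+2).
  have hB : ∀ t : ℝ, HasDerivAt (fun t : ℝ => smoothing f σ x +
      t * inner ℝ (smoothingGrad f σ x) w + A / 2 * ‖w‖ ^ 2 * t ^ 2 +
      C / ((m : ℝ) + 2) * ‖w‖ ^ (m + 2) * t ^ (m + 2))
      (inner ℝ (smoothingGrad f σ x) w + A * ‖w‖ ^ 2 * t + C * ‖w‖ ^ (m + 2) * t ^ (m + 1)) t := by
    intro t
    have h1 := ((((hasDerivAt_id t).mul_const (inner ℝ (smoothingGrad f σ x) w)).const_add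
      (smoothing f σ x)).add ((hasDerivAt_pow 2 t).const_mul (A / 2 * ‖w‖ ^ 2))).add
      ((hasDerivAt_pow (m + 2) t).const_mul (C / ((m : ℝ) + 2) * ‖w‖ ^ (m + 2)))
    refine h1.congr_deriv ?_
    push_cast
    field_simp
  have key := image_le_of_deriv_right_le_deriv_boundary
    (f := fun t : ℝ => smoothing f σ (x + t • w)) (a := 0) (b := 1)
    (fun t _ => (hline t).continuousAt.continuousWithinAt)
    (fun t _ => (hline t).hasDerivWithinAt) (by simp)
    (fun t _ => (hB t).continuousAt.continuousWithinAt)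
    (fun t _ => (hB t).hasDerivWithinAt)
    (fun t ht => by
      have h1 := hf.norm_smoothingGrad_sub_le hσ x (t • w)
      have h2 := real_inner_le_norm (smoothingGrad f σ (x + t • w) - smoothingGrad f σ x) w
      rw [inner_sub_left] at h2
      rw [norm_smul, Real.norm_of_nonneg ht.1] at h1
      have h3 : ‖smoothingGrad f σ (x + t • w) - smoothingGrad f σ x‖ * ‖w‖ ≤
          ((A + C * (t * ‖w‖) ^ m) * (t * ‖w‖)) * ‖w‖ := by gcongr
      have h4 : ((A + C * (t * ‖w‖) ^ m) * (t * ‖w‖)) * ‖w‖ =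
        A * ‖w‖ ^ 2 * t + C * ‖w‖ ^ (m + 2) * t ^ (m + 1) := by ring
      linarith)
  have := key (x := 1) ⟨zero_le_one, le_rfl⟩
  simpa using this

lemma IsSPB.abs_smoothing_sub_le (hf : IsSPB f R₁ R₂ m) (hσ : 0 < σ) (x : Vec d) :
    |smoothing f σ x - f x| ≤ constM R₁ R₂ m σ x * σ := by
  have hR₁ := hf.R₁_nonneg
  have hR₂ := hf.R₂_pos.le
  have h1 : smoothing f σ x - f x = ∫ u, (f (x + σ • u) - f x) ∂(gauss d) := by
    rw [integral_sub (hf.integrable_comp hσ x) (integrable_const _)]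
    simp [smoothing]
  rw [h1, ← Real.norm_eq_abs]
  refine (norm_integral_le_of_norm_le ((integrable_affine_norm_add_norm_pow _ _ _).const_mul σ)
    (Eventually.of_forall fun u => hf.abs_sub_smul_le hσ x u)).trans ?_
  rw [integral_const_mul, mul_comm]
  gcongr
  exact integral_affine_norm_add_norm_pow_le (by positivity) (by positivity) m

lemma IsSPB.iInf_le_smoothing (hf : IsSPB f R₁ R₂ m) (hbdd : BddBelow (Set.range f)) (hσ : 0 < σ)
    (x : Vec d) : ⨅ y, f y ≤ smoothing f σ x := by
  have h := integral_mono (integrable_const (⨅ y, f y)) (hf.integrable_comp hσ x)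
    fun u => ciInf_le hbdd (x + σ • u)
  simpa [smoothing] using h

/-! ### Moments and unbiasedness of the two-point estimator. -/

lemma add_add_pow_le {a b c : ℝ} (ha : 0 ≤ a) (hb : 0 ≤ b) (hc : 0 ≤ c) {p : ℕ} (hp : p ≠ 0) :
    (a + b + c) ^ p ≤ (3 : ℝ) ^ (p - 1) * (a ^ p + b ^ p + c ^ p) := by
  obtain ⟨n, rfl⟩ := Nat.exists_eq_succ_of_ne_zero hp
  have h := pow_sum_div_card_le_sum_pow (s := Finset.univ) (f := ![a, b, c])
    (by intro i _; fin_cases i <;> assumption) n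
  rw [Fin.sum_univ_three, Fin.sum_univ_three, Finset.card_univ, Fintype.card_fin,
    div_le_iff₀ (by positivity)] at h
  simpa [mul_comm] using h

lemma IsSPB.norm_estimator_le (hf : IsSPB f R₁ R₂ m) (hσ : 0 < σ) (x u : Vec d) :
    ‖estimator f σ x u‖ ≤ (2 : ℝ) ^ ((m : ℤ) - 1) * R₁ * ‖x‖ ^ m * ‖u‖ ^ 2 + R₂ * ‖u‖ ^ 2 +
      (2 : ℝ) ^ ((m : ℤ) - 1) * R₁ * σ ^ m * ‖u‖ ^ (m + 2) := by
  rw [estimator, norm_smul, norm_mul, Real.norm_of_nonneg (one_div_pos.2 hσ).le, Real.norm_eq_abs]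
  calc 1 / σ * |f (x + σ • u) - f x| * ‖u‖
      ≤ 1 / σ * (σ * (((2 : ℝ) ^ ((m : ℤ) - 1) * R₁ * ‖x‖ ^ m + R₂) * ‖u‖ +
        (2 : ℝ) ^ ((m : ℤ) - 1) * R₁ * σ ^ m * ‖u‖ ^ (m + 1))) * ‖u‖ := by
        gcongr
        exact hf.abs_sub_smul_le hσ x u
    _ = _ := by
      field_simp
      ring

lemma IsSPB.continuous_estimator (hf : IsSPB f R₁ R₂ m) :
    Continuous (fun p : Vec d × Vec d => estimator f σ p.1 p.2) := by
  have := hf.continuous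
  unfold estimator
  fun_prop

/-- The pointwise bound on `‖estimator‖ ^ p` obtained from the power mean inequality. -/
lemma IsSPB.norm_estimator_pow_le (hf : IsSPB f R₁ R₂ m) (hσ : 0 < σ) (x u : Vec d) {p : ℕ}
    (hp : p ≠ 0) : ‖estimator f σ x u‖ ^ p ≤
      (3 : ℝ) ^ (p - 1) * ((((2 : ℝ) ^ ((m : ℤ) - 1) * R₁) ^ p * ‖x‖ ^ (m * p) + R₂ ^ p) *
        ‖u‖ ^ (2 * p) + ((2 : ℝ) ^ ((m : ℤ) - 1) * R₁) ^ p * σ ^ (m * p) * ‖u‖ ^ ((m + 2) * p)) := by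
  have hR₁ := hf.R₁_nonneg
  have hR₂ := hf.R₂_pos.le
  calc ‖estimator f σ x u‖ ^ p ≤ _ :=
        pow_le_pow_left₀ (norm_nonneg _) (hf.norm_estimator_le hσ x u) p
    _ ≤ _ := add_add_pow_le (by positivity) (by positivity) (by positivity) hp
    _ = _ := by ring

lemma IsSPB.integrable_norm_estimator_pow (hf : IsSPB f R₁ R₂ m) (hσ : 0 < σ) (x : Vec d) {p : ℕ}
    (hp : p ≠ 0) : Integrable (fun u => ‖estimator f σ x u‖ ^ p) (gauss d) := by
  have h1 := (hf.continuous_estimator (σ := σ)).comp (Continuous.prodMk_right x)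
  set b := (2 : ℝ) ^ ((m : ℤ) - 1)
  refine ((((integrable_norm_pow (2 * p)).const_mul
    ((b * R₁) ^ p * ‖x‖ ^ (m * p) + R₂ ^ p)).add
    ((integrable_norm_pow ((m + 2) * p)).const_mul ((b * R₁) ^ p * σ ^ (m * p)))).const_mul
    ((3 : ℝ) ^ (p - 1))).mono'
    (h1.norm.pow p).aestronglyMeasurable (Eventually.of_forall fun u => ?_)
  rw [Real.norm_of_nonneg (by positivity)]
  exact hf.norm_estimator_pow_le hσ x u hp

lemma constH_nonneg (hf : IsSPB f R₁ R₂ m) (hσ : 0 < σ) (p : ℕ) :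
    0 ≤ constH d R₁ R₂ m σ p := by
  have := hf.R₁_nonneg
  have := hf.R₂_pos
  rw [constH]
  split_ifs
  · exact zero_le_one
  · exact mul_nonneg (by positivity) (le_max_of_le_right (by positivity))

/-- Moment bound for the two-point estimator. -/
lemma IsSPB.integral_norm_estimator_pow_le (hf : IsSPB f R₁ R₂ m) (hσ : 0 < σ) (x : Vec d) {p : ℕ}
    (hp : p ≠ 0) : ∫ u, ‖estimator f σ x u‖ ^ p ∂(gauss d) ≤
      constH d R₁ R₂ m σ p * (‖x‖ ^ (m * p) + 1) := by
  have hR₁ := hf.R₁_nonneg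
  have hR₂ := hf.R₂_pos.le
  set b := (2 : ℝ) ^ ((m : ℤ) - 1) with hb
  have hb0 : 0 < b := by positivity
  set c := (2 * (p : ℝ) + d) ^ p with hc
  have hc0 : 0 ≤ c := by positivity
  set e := (((m : ℝ) + 2) * p + d) ^ (((m : ℝ) + 2) * p / 2)
  have hbp : (2 : ℝ) ^ (((m : ℤ) - 1) * p) = b ^ p := by rw [zpow_mul, zpow_natCast]
  have hi1 : ∫ u, ‖u‖ ^ (2 * p) ∂(gauss d) ≤ c := by
    refine (integral_norm_pow_le d (2 * p)).trans_eq ?_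
    rw [hc, ← Real.rpow_natCast]
    push_cast
    rw [mul_div_cancel_left₀ _ two_ne_zero]
  have hi2 : ∫ u, ‖u‖ ^ ((m + 2) * p) ∂(gauss d) ≤ e := by
    refine (integral_norm_pow_le d ((m + 2) * p)).trans_eq ?_
    push_cast
    rfl
  have h1 : Integrable (fun u : Vec d => ((b * R₁) ^ p * ‖x‖ ^ (m * p) + R₂ ^ p) * ‖u‖ ^ (2 * p))
    (gauss d) := (integrable_norm_pow (2 * p)).const_mul _
  have h2 : Integrable (fun u : Vec d => (b * R₁) ^ p * σ ^ (m * p) * ‖u‖ ^ ((m + 2) * p))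
    (gauss d) := (integrable_norm_pow ((m + 2) * p)).const_mul _
  calc ∫ u, ‖estimator f σ x u‖ ^ p ∂(gauss d)
      ≤ ∫ u, (3 : ℝ) ^ (p - 1) * (((b * R₁) ^ p * ‖x‖ ^ (m * p) + R₂ ^ p) * ‖u‖ ^ (2 * p) +
          (b * R₁) ^ p * σ ^ (m * p) * ‖u‖ ^ ((m + 2) * p)) ∂(gauss d) :=
        integral_mono (hf.integrable_norm_estimator_pow hσ x hp) ((h1.add h2).const_mul _)
          fun u => hf.norm_estimator_pow_le hσ x u hp
    _ = (3 : ℝ) ^ (p - 1) * (((b * R₁) ^ p * ‖x‖ ^ (m * p) + R₂ ^ p) *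
          ∫ u, ‖u‖ ^ (2 * p) ∂(gauss d) +
          (b * R₁) ^ p * σ ^ (m * p) * ∫ u, ‖u‖ ^ ((m + 2) * p) ∂(gauss d)) := by
        rw [integral_const_mul, integral_add h1 h2, integral_const_mul, integral_const_mul]
    _ ≤ (3 : ℝ) ^ (p - 1) * (((b * R₁) ^ p * ‖x‖ ^ (m * p) + R₂ ^ p) * c +
          (b * R₁) ^ p * σ ^ (m * p) * e) := by gcongr
    _ = (3 : ℝ) ^ (p - 1) * ((b ^ p * R₁ ^ p * c) * ‖x‖ ^ (m * p) +
          (R₂ ^ p * c + b ^ p * R₁ ^ p * σ ^ (m * p) * e)) := by ring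
    _ ≤ (3 : ℝ) ^ (p - 1) * (max (b ^ p * R₁ ^ p * c)
          (R₂ ^ p * c + b ^ p * R₁ ^ p * σ ^ (m * p) * e) * ‖x‖ ^ (m * p) +
          max (b ^ p * R₁ ^ p * c) (R₂ ^ p * c + b ^ p * R₁ ^ p * σ ^ (m * p) * e)) := by
        gcongr
        · exact le_max_left _ _
        · exact le_max_right _ _
    _ = constH d R₁ R₂ m σ p * (‖x‖ ^ (m * p) + 1) := by
        rw [constH, if_neg hp, hbp]
        ring

lemma IsSPB.integrable_estimator (hf : IsSPB f R₁ R₂ m) (hσ : 0 < σ) (x : Vec d) :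
    Integrable (estimator f σ x) (gauss d) := by
  have h1 := (hf.continuous_estimator (σ := σ)).comp (Continuous.prodMk_right x)
  refine (integrable_norm_iff h1.aestronglyMeasurable).1 ?_
  simpa using hf.integrable_norm_estimator_pow hσ x one_ne_zero

/-- The two-point estimator is unbiased for the gradient of the smoothing. -/
lemma IsSPB.integral_estimator (hf : IsSPB f R₁ R₂ m) (hσ : 0 < σ) (x : Vec d) :
    ∫ u, estimator f σ x u ∂(gauss d) = smoothingGrad f σ x := by
  -- The subtracted term has mean zero, because u is centred.
  have h : ∀ u, estimator f σ x u = σ⁻¹ • (f (x + σ • u) • u - f x • u) := fun u => by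
    rw [estimator, ← sub_smul, smul_smul, one_div]
  have h0 : Integrable (fun u : Vec d => f x • u) (gauss d) :=
    (IsGaussian.integrable_id (μ := gauss d)).smul (f x)
  simp_rw [h]
  rw [integral_smul, integral_sub (hf.integrable_comp_smul hσ x) h0, integral_smul,
    integral_id_stdGaussian, smul_zero, sub_zero, smoothingGrad]

/-! ### Expected descent from a fixed point. -/

lemma pow_add_one_le_sq_add_one_pow {q : ℝ} (hq : 0 ≤ q) {p : ℕ} (hp : 2 ≤ p) :
    q ^ p + 1 ≤ (q ^ 2 + 1) ^ p := by
  rcases le_total q 1 with h | h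
  · have h1 : q ^ p ≤ q ^ 2 := pow_le_pow_of_le_one hq h hp
    have h2 : q ^ 2 + 1 ≤ (q ^ 2 + 1) ^ p :=
      le_self_pow₀ (by nlinarith [sq_nonneg q]) (by omega)
    linarith
  · have h1 : q ^ p ≤ (q ^ 2) ^ p := by gcongr; nlinarith
    have h2 : (q ^ 2) ^ p + 1 ^ p ≤ (q ^ 2 + 1) ^ p :=
      pow_add_pow_le (by positivity) zero_le_one (by omega)
    rw [one_pow] at h2
    linarith

/-- The step size, normalised by the growth of the gradient. -/
def stepSize (m : ℕ) (t : ℝ) (x : Vec d) : ℝ := t / (‖x‖ ^ (2 * m) + 1)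

lemma continuous_stepSize (m : ℕ) (t : ℝ) : Continuous (stepSize (d := d) m t) := by
  unfold stepSize
  exact continuous_const.div (by fun_prop) fun x => by positivity

/-- The function lies between inf f and the right side of the descent inequality, which is
integrable by the estimator moments. -/
lemma IsSPB.integrable_smoothing_step (hf : IsSPB f R₁ R₂ m) (hbdd : BddBelow (Set.range f))
    (hσ : 0 < σ) (x : Vec d) (s : ℝ) :
    Integrable (fun u => smoothing f σ (x - s • estimator f σ x u)) (gauss d) := by
  have h1 := (hf.continuous_estimator (σ := σ)).comp (Continuous.prodMk_right x)
  have hcont : Continuous (fun u => smoothing f σ (x - s • estimator f σ x u)) :=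
    (hf.continuous_smoothing hσ).comp (continuous_const.sub (h1.const_smul s))
  have hub : Integrable (fun u => smoothing f σ x +
      inner ℝ (smoothingGrad f σ x) (-(s • estimator f σ x u)) +
      (constA d R₁ R₂ m σ + constB d R₁ m σ * ‖x‖ ^ m) / 2 * ‖-(s • estimator f σ x u)‖ ^ 2 +
      constC d R₁ m σ / ((m : ℝ) + 2) * ‖-(s • estimator f σ x u)‖ ^ (m + 2)) (gauss d) := by
    simp only [norm_neg, norm_smul, mul_pow]
    refine (((integrable_const _).add ?_).add ?_).add ?_
    · exact ((hf.integrable_estimator hσ x).smul s).neg.const_inner _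
    · exact ((hf.integrable_norm_estimator_pow hσ x two_ne_zero).const_mul _).const_mul _
    · exact ((hf.integrable_norm_estimator_pow hσ x (by omega)).const_mul _).const_mul _
  refine ((integrable_const |⨅ y, f y|).add hub.abs).mono' hcont.aestronglyMeasurable
    (Eventually.of_forall fun u => ?_)
  have hlo := hf.iInf_le_smoothing hbdd hσ (x - s • estimator f σ x u)
  have hhi := hf.smoothing_add_le hσ x (-(s • estimator f σ x u))
  rw [← sub_eq_add_neg] at hhi
  simp only [Pi.add_apply, Real.norm_eq_abs]
  refine abs_le.2 ⟨?_, ?_⟩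
  · linarith [neg_abs_le (⨅ y, f y), abs_nonneg (smoothing f σ x +
      inner ℝ (smoothingGrad f σ x) (-(s • estimator f σ x u)) +
      (constA d R₁ R₂ m σ + constB d R₁ m σ * ‖x‖ ^ m) / 2 * ‖-(s • estimator f σ x u)‖ ^ 2 +
      constC d R₁ m σ / ((m : ℝ) + 2) * ‖-(s • estimator f σ x u)‖ ^ (m + 2))]
  · exact hhi.trans ((le_abs_self _).trans (le_add_of_nonneg_left (abs_nonneg _)))

/-- Expected decrease of the smoothing along one step from a fixed point. -/
lemma IsSPB.integral_smoothing_step_le (hf : IsSPB f R₁ R₂ m) (hbdd : BddBelow (Set.range f))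
    (hσ : 0 < σ) (x : Vec d) {t : ℝ} (ht : 0 < t) :
    ∫ u, smoothing f σ (x - stepSize m t x • estimator f σ x u) ∂(gauss d) ≤
      smoothing f σ x - t * ‖(‖x‖ ^ m + 1)⁻¹ • smoothingGrad f σ x‖ ^ 2 +
        (constH d R₁ R₂ m σ 2 * t ^ 2 * (constA d R₁ R₂ m σ + constB d R₁ m σ) / 2 +
        constC d R₁ m σ / ((m : ℝ) + 2) * constH d R₁ R₂ m σ (m + 2) * t ^ (m + 2)) := by
  have hA := constA_nonneg (d := d) hf hσ
  have hB := constB_nonneg (d := d) hf hσ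
  have hC := constC_nonneg (d := d) hf hσ
  have hH := constH_nonneg (d := d) hf hσ
  set A := constA d R₁ R₂ m σ
  set B := constB d R₁ m σ
  set C := constC d R₁ m σ
  set g := smoothingGrad f σ x
  set s := stepSize m t x with hs
  set q := ‖x‖ ^ m with hq
  have hq0 : 0 ≤ q := by positivity
  set D := q ^ 2 + 1 with hD
  have hD0 : 0 < D := by positivity
  have hsD : s = t / D := by
    rw [hs, stepSize, hD, hq, ← pow_mul, mul_comm m 2]
  have hs0 : 0 ≤ s := by rw [hsD]; positivity
  have i1 : Integrable (fun u => s * inner ℝ g (estimator f σ x u)) (gauss d) :=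
    ((hf.integrable_estimator hσ x).const_inner g).const_mul s
  have i2 : Integrable (fun u => (A + B * q) / 2 * (s ^ 2 * ‖estimator f σ x u‖ ^ 2)) (gauss d) :=
    ((hf.integrable_norm_estimator_pow hσ x two_ne_zero).const_mul _).const_mul _
  have i3 : Integrable (fun u => C / ((m : ℝ) + 2) *
      (s ^ (m + 2) * ‖estimator f σ x u‖ ^ (m + 2))) (gauss d) :=
    ((hf.integrable_norm_estimator_pow hσ x (by omega)).const_mul _).const_mul _
  have i01 : Integrable (fun u => smoothing f σ x - s * inner ℝ g (estimator f σ x u)) (gauss d) :=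
    (integrable_const _).sub i1
  have i012 : Integrable (fun u => smoothing f σ x - s * inner ℝ g (estimator f σ x u) +
    (A + B * q) / 2 * (s ^ 2 * ‖estimator f σ x u‖ ^ 2)) (gauss d) := i01.add i2
  have m2 := hf.integral_norm_estimator_pow_le hσ x two_ne_zero
  have m3 := hf.integral_norm_estimator_pow_le hσ x (show m + 2 ≠ 0 by omega)
  rw [pow_mul, ← hq, ← hD] at m2
  rw [pow_mul, ← hq] at m3
  -- Weakened to a full power of D, so that it cancels exactly against s^(m+2).
  have m3' := m3.trans (mul_le_mul_of_nonneg_left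
    (pow_add_one_le_sq_add_one_pow hq0 (show 2 ≤ m + 2 by omega)) (hH _))
  rw [← hD] at m3'
  have step1 : ∫ u, smoothing f σ (x - s • estimator f σ x u) ∂(gauss d) ≤
      smoothing f σ x - s * ‖g‖ ^ 2 + (A + B * q) / 2 * (s ^ 2 * (constH d R₁ R₂ m σ 2 * D)) +
      C / ((m : ℝ) + 2) * (s ^ (m + 2) * (constH d R₁ R₂ m σ (m + 2) * D ^ (m + 2))) := by
    calc ∫ u, smoothing f σ (x - s • estimator f σ x u) ∂(gauss d)
        ≤ ∫ u, (smoothing f σ x - s * inner ℝ g (estimator f σ x u) +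
          (A + B * q) / 2 * (s ^ 2 * ‖estimator f σ x u‖ ^ 2) +
          C / ((m : ℝ) + 2) * (s ^ (m + 2) * ‖estimator f σ x u‖ ^ (m + 2))) ∂(gauss d) := by
          refine integral_mono (hf.integrable_smoothing_step hbdd hσ x s) (i012.add i3)
            fun u => ?_
          have h := hf.smoothing_add_le hσ x (-(s • estimator f σ x u))
          rw [← sub_eq_add_neg, inner_neg_right, inner_smul_right, norm_neg, norm_smul,
            Real.norm_of_nonneg hs0, mul_pow, mul_pow, ← sub_eq_add_neg] at h
          exact h
      _ = smoothing f σ x - s * ‖g‖ ^ 2 +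
          (A + B * q) / 2 * (s ^ 2 * ∫ u, ‖estimator f σ x u‖ ^ 2 ∂(gauss d)) +
          C / ((m : ℝ) + 2) * (s ^ (m + 2) * ∫ u, ‖estimator f σ x u‖ ^ (m + 2) ∂(gauss d)) := by
          rw [integral_add i012 i3, integral_add i01 i2,
            integral_sub (integrable_const _) i1]
          simp only [integral_const_mul]
          rw [integral_inner (hf.integrable_estimator hσ x), hf.integral_estimator hσ x,
            real_inner_self_eq_norm_sq]
          simp
      _ ≤ _ := by gcongr
  have e2 : (A + B * q) / 2 * (s ^ 2 * (constH d R₁ R₂ m σ 2 * D)) ≤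
      constH d R₁ R₂ m σ 2 * t ^ 2 * (A + B) / 2 := by
    -- One factor D comes from the second moment; this supplies the other one needed to cancel s² =
    -- t²/D².
    have h1 : A + B * q ≤ (A + B) * D := by
      have hqD : q ≤ D := by nlinarith [sq_nonneg (q - 1)]
      have h1D : 1 ≤ D := by nlinarith [sq_nonneg q]
      nlinarith
    have h2 : s ^ 2 * D * (A + B * q) ≤ t ^ 2 * (A + B) := by
      calc s ^ 2 * D * (A + B * q) ≤ s ^ 2 * D * ((A + B) * D) := by gcongr
        _ = t ^ 2 * (A + B) := by rw [hsD]; field_simp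
    nlinarith [mul_le_mul_of_nonneg_left h2 (hH 2)]
  have e3 : C / ((m : ℝ) + 2) * (s ^ (m + 2) * (constH d R₁ R₂ m σ (m + 2) * D ^ (m + 2))) =
      C / ((m : ℝ) + 2) * constH d R₁ R₂ m σ (m + 2) * t ^ (m + 2) := by
    rw [hsD, div_pow]
    field_simp
  -- This is D = q² + 1 ≤ (q + 1)².
  have e1 : t * ‖(q + 1)⁻¹ • g‖ ^ 2 ≤ s * ‖g‖ ^ 2 := by
    rw [norm_smul, mul_pow, Real.norm_of_nonneg (by positivity), hsD, ← mul_assoc]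
    gcongr
    rw [inv_pow, ← div_eq_mul_inv]
    gcongr
    nlinarith
  linarith

/-! ### The random trajectory: measurability, independence, moments. -/

lemma iterates_congr (f : Vec d → ℝ) (m : ℕ) (σ : ℝ) (τ : ℕ → ℝ) (x₀ : Vec d) {v w : ℕ → Vec d}
    (k : ℕ) (h : ∀ j < k, v j = w j) :
    iterates f m σ τ x₀ v k = iterates f m σ τ x₀ w k := by
  induction k with
  | zero => rfl
  | succ k ih =>
    rw [iterates, iterates, ih fun j hj => h j (hj.trans k.lt_succ_self), h k k.lt_succ_self]

lemma iterates_succ (f : Vec d → ℝ) (m : ℕ) (σ : ℝ) (τ : ℕ → ℝ) (x₀ : Vec d) (v : ℕ → Vec d)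
    (k : ℕ) : iterates f m σ τ x₀ v (k + 1) = iterates f m σ τ x₀ v k -
      stepSize m (τ k) (iterates f m σ τ x₀ v k) • estimator f σ (iterates f m σ τ x₀ v k) (v k) :=
  rfl

lemma IsSPB.continuous_step (hf : IsSPB f R₁ R₂ m) (t : ℝ) :
    Continuous (fun p : Vec d × Vec d => p.1 - stepSize m t p.1 • estimator f σ p.1 p.2) :=
  continuous_fst.sub (((continuous_stepSize m t).comp continuous_fst).smul hf.continuous_estimator)

lemma IsSPB.measurable_iterates (hf : IsSPB f R₁ R₂ m) (τ : ℕ → ℝ) (x₀ : Vec d) (k : ℕ) :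
    Measurable (fun v : ℕ → Vec d => iterates f m σ τ x₀ v k) := by
  induction k with
  | zero => exact measurable_const
  | succ k ih =>
    simp only [iterates_succ]
    exact (hf.continuous_step (σ := σ) (τ k)).measurable.comp (ih.prodMk (measurable_pi_apply k))

section Trajectory

variable {Ω : Type*} [MeasurableSpace Ω] {P : Measure Ω} {u : ℕ → Ω → Vec d}

lemma IsSPB.aemeasurable_iterates (hf : IsSPB f R₁ R₂ m) (τ : ℕ → ℝ) (x₀ : Vec d)
    (hu : ∀ k, AEMeasurable (u k) P) (k : ℕ) :
    AEMeasurable (fun ω => iterates f m σ τ x₀ (fun j => u j ω) k) P :=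
  (hf.measurable_iterates τ x₀ k).comp_aemeasurable (aemeasurable_pi_lambda _ hu)

/-- The `k`-th iterate only depends on the directions of index `< k`. -/
lemma IsSPB.indepFun_iterates (hf : IsSPB f R₁ R₂ m) (τ : ℕ → ℝ) (x₀ : Vec d)
    (hu : ∀ k, AEMeasurable (u k) P) (hindep : iIndepFun u P) (k : ℕ) :
    IndepFun (fun ω => iterates f m σ τ x₀ (fun j => u j ω) k) (u k) P := by
  have h := hindep.indepFun_finset₀ (Finset.range k) {k} (by simp) hu
  -- Padding by 0 is harmless: by `iterates_congr` the k-th iterate never reads indices ≥ k.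
  let ext : (Finset.range k → Vec d) → ℕ → Vec d :=
    fun v j => if hj : j ∈ Finset.range k then v ⟨j, hj⟩ else 0
  have hext : Measurable ext := by
    refine measurable_pi_lambda _ fun j => ?_
    by_cases hj : j ∈ Finset.range k
    · simp only [ext, dif_pos hj]
      exact measurable_pi_apply _
    · simp only [ext, dif_neg hj]
      exact measurable_const
  have h2 := h.comp (φ := fun v => iterates f m σ τ x₀ (ext v) k)
    (ψ := fun v : (({k} : Finset ℕ) → Vec d) => v ⟨k, Finset.mem_singleton_self k⟩)
    ((hf.measurable_iterates τ x₀ k).comp hext)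
    (measurable_pi_apply (X := fun _ : ({k} : Finset ℕ) => Vec d) ⟨k, Finset.mem_singleton_self k⟩)
  have h3 : (fun ω => iterates f m σ τ x₀ (fun j => u j ω) k) =
      (fun v => iterates f m σ τ x₀ (ext v) k) ∘ fun ω (i : Finset.range k) => u i ω := by
    ext1 ω
    refine iterates_congr f m σ τ x₀ k fun j hj => ?_
    simp [ext, hj]
  rw [h3]
  exact h2

lemma integrable_norm_pow_comp {k : ℕ} (hu : HasLaw (u k) (gauss d) P) (n : ℕ) :
    Integrable (fun ω => ‖u k ω‖ ^ n) P := by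
  have h := integrable_norm_pow (d := d) n
  rw [← hu.map_eq] at h
  exact h.comp_aemeasurable hu.aemeasurable

/-- Both s ≤ 1 and s‖x‖^m ≤ 1, so the normalisation absorbs the growth in x. The displacement is
then bounded by a polynomial in ‖v‖ alone, and moments propagate by induction. -/
lemma IsSPB.norm_step_le (hf : IsSPB f R₁ R₂ m) (hσ : 0 < σ) {t : ℝ} (ht : t ∈ Set.Ioc (0 : ℝ) 1)
    (x v : Vec d) : ‖x - stepSize m t x • estimator f σ x v‖ ≤
      ‖x‖ + ((2 : ℝ) ^ ((m : ℤ) - 1) * R₁ + R₂) * ‖v‖ ^ 2 +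
        (2 : ℝ) ^ ((m : ℤ) - 1) * R₁ * σ ^ m * ‖v‖ ^ (m + 2) := by
  have hR₁ := hf.R₁_nonneg
  have hR₂ := hf.R₂_pos.le
  set b := (2 : ℝ) ^ ((m : ℤ) - 1)
  have hs : 0 ≤ stepSize m t x := div_nonneg ht.1.le (by positivity)
  have hD : ‖x‖ ^ (2 * m) + 1 = (‖x‖ ^ m) ^ 2 + 1 := by rw [← pow_mul, mul_comm]
  have hs1 : stepSize m t x ≤ 1 := by
    rw [stepSize, div_le_one (by positivity), hD]
    nlinarith [ht.2, sq_nonneg (‖x‖ ^ m)]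
  have hsq : stepSize m t x * ‖x‖ ^ m ≤ 1 := by
    rw [stepSize, div_mul_eq_mul_div, div_le_one (by positivity), hD]
    have h1 : t * ‖x‖ ^ m ≤ 1 * ‖x‖ ^ m := by gcongr; exact ht.2
    nlinarith [sq_nonneg (‖x‖ ^ m - 1), h1, sq_nonneg (‖x‖ ^ m)]
  calc ‖x - stepSize m t x • estimator f σ x v‖
      ≤ ‖x‖ + stepSize m t x * ‖estimator f σ x v‖ := by
        refine (norm_sub_le _ _).trans_eq ?_
        rw [norm_smul, Real.norm_of_nonneg hs]
    _ ≤ ‖x‖ + stepSize m t x * (b * R₁ * ‖x‖ ^ m * ‖v‖ ^ 2 + R₂ * ‖v‖ ^ 2 +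
        b * R₁ * σ ^ m * ‖v‖ ^ (m + 2)) := by
        gcongr
        exact hf.norm_estimator_le hσ x v
    _ = ‖x‖ + (stepSize m t x * ‖x‖ ^ m) * (b * R₁ * ‖v‖ ^ 2) + stepSize m t x * (R₂ * ‖v‖ ^ 2) +
        stepSize m t x * (b * R₁ * σ ^ m * ‖v‖ ^ (m + 2)) := by ring
    _ ≤ ‖x‖ + 1 * (b * R₁ * ‖v‖ ^ 2) + 1 * (R₂ * ‖v‖ ^ 2) +
        1 * (b * R₁ * σ ^ m * ‖v‖ ^ (m + 2)) := by gcongr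
    _ = _ := by ring

/-- All moments of the iterates are finite. -/
lemma IsSPB.integrable_norm_iterates_pow [IsProbabilityMeasure P] (hf : IsSPB f R₁ R₂ m) (hσ : 0 < σ) {τ : ℕ → ℝ}
    (hτ : ∀ k, τ k ∈ Set.Ioc (0 : ℝ) 1) (x₀ : Vec d) (hu : ∀ k, HasLaw (u k) (gauss d) P)
    (k n : ℕ) : Integrable (fun ω => ‖iterates f m σ τ x₀ (fun j => u j ω) k‖ ^ n) P := by
  have hR₁ := hf.R₁_nonneg
  have hR₂ := hf.R₂_pos.le
  rcases eq_or_ne n 0 with rfl | hn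
  · simp
  induction k with
  | zero => exact (integrable_const (‖x₀‖ ^ n) : Integrable (fun _ : Ω => ‖x₀‖ ^ n) P)
  | succ k ih =>
    set b := (2 : ℝ) ^ ((m : ℤ) - 1)
    refine (((ih.add ((integrable_norm_pow_comp (hu k) (2 * n)).const_mul ((b * R₁ + R₂) ^ n))).add
      ((integrable_norm_pow_comp (hu k) ((m + 2) * n)).const_mul
        ((b * R₁ * σ ^ m) ^ n))).const_mul ((3 : ℝ) ^ (n - 1))).mono'
      ((hf.aemeasurable_iterates τ x₀ (fun k => (hu k).aemeasurable)
        (k + 1)).norm.pow_const n).aestronglyMeasurable (Eventually.of_forall fun ω => ?_)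
    rw [Real.norm_of_nonneg (by positivity), iterates_succ]
    refine (pow_le_pow_left₀ (norm_nonneg _) (hf.norm_step_le hσ (hτ k) _ _) n).trans ?_
    refine (add_add_pow_le (by positivity) (by positivity) (by positivity) hn).trans_eq ?_
    simp only [Pi.add_apply, mul_pow, ← pow_mul, b]

/-- Comparison through f(0) and f(x). Polynomial growth in ‖x‖ reduces integrability along the
trajectory to moments of the iterates. -/
lemma IsSPB.abs_smoothing_le (hf : IsSPB f R₁ R₂ m) (hσ : 0 < σ) (x : Vec d) :
    |smoothing f σ x| ≤ |f 0| + ((2 : ℝ) ^ ((m : ℤ) - 1) * R₁ * (0 ^ m + ‖x‖ ^ m) + R₂) * ‖x‖ +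
      constM R₁ R₂ m σ x * σ := by
  have h1 := hf.abs_smoothing_sub_le hσ x
  have h2 := hf.abs_sub_le 0 x
  rw [zero_add, norm_zero] at h2
  have h3 := abs_add_le (f 0) ((f x - f 0) + (smoothing f σ x - f x))
  have h4 := abs_add_le (f x - f 0) (smoothing f σ x - f x)
  rw [show f 0 + ((f x - f 0) + (smoothing f σ x - f x)) = smoothing f σ x by ring] at h3
  linarith

lemma IsSPB.norm_smoothingGrad_le (hf : IsSPB f R₁ R₂ m) (hσ : 0 < σ) (x : Vec d) :
    ‖smoothingGrad f σ x‖ ≤ ‖smoothingGrad f σ 0‖ +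
      (constA d R₁ R₂ m σ + constB d R₁ m σ * 0 ^ m) * ‖x‖ + constC d R₁ m σ * ‖x‖ ^ (m + 1) := by
  have h1 := hf.norm_smoothingGrad_sub_le hσ 0 x
  rw [zero_add, norm_zero] at h1
  have h2 := norm_add_le (smoothingGrad f σ 0) (smoothingGrad f σ x - smoothingGrad f σ 0)
  rw [add_sub_cancel] at h2
  calc ‖smoothingGrad f σ x‖ ≤ _ := h2
    _ ≤ _ := add_le_add_right h1 _
    _ = _ := by ring

lemma IsSPB.integrable_smoothing_of_moments [IsProbabilityMeasure P] (hf : IsSPB f R₁ R₂ m) (hσ : 0 < σ) {X : Ω → Vec d}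
    (hX : AEMeasurable X P) (hmom : ∀ n : ℕ, Integrable (fun ω => ‖X ω‖ ^ n) P) :
    Integrable (fun ω => smoothing f σ (X ω)) P := by
  have h1 : Integrable (fun ω => ‖X ω‖) P := by simpa using hmom 1
  have hb : Integrable (fun ω => |f 0| +
      ((2 : ℝ) ^ ((m : ℤ) - 1) * R₁ * (0 ^ m + ‖X ω‖ ^ m) + R₂) * ‖X ω‖ +
      constM R₁ R₂ m σ (X ω) * σ) P := by
    refine ((integrable_const _).add ?_).add ?_
    · have h2 := (h1.const_mul ((2 : ℝ) ^ ((m : ℤ) - 1) * R₁ * 0 ^ m + R₂)).add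
        ((hmom (m + 1)).const_mul ((2 : ℝ) ^ ((m : ℤ) - 1) * R₁))
      refine h2.congr (Eventually.of_forall fun ω => ?_)
      simp only [Pi.add_apply]
      ring
    · exact ((((hmom m).const_mul _).add (integrable_const _)).mul_const _ |>.add
        (integrable_const _)).mul_const σ
  exact hb.mono' ((hf.continuous_smoothing hσ).measurable.comp_aemeasurable hX).aestronglyMeasurable
    (Eventually.of_forall fun ω => hf.abs_smoothing_le hσ (X ω))

lemma IsSPB.integrable_norm_smoothingGrad_sq_of_moments [IsProbabilityMeasure P] (hf : IsSPB f R₁ R₂ m) (hσ : 0 < σ)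
    {X : Ω → Vec d} (hX : AEMeasurable X P) (hmom : ∀ n : ℕ, Integrable (fun ω => ‖X ω‖ ^ n) P) :
    Integrable (fun ω => ‖(‖X ω‖ ^ m + 1)⁻¹ • smoothingGrad f σ (X ω)‖ ^ 2) P := by
  have hA := constA_nonneg (d := d) hf hσ
  have hB := constB_nonneg (d := d) hf hσ
  have hC := constC_nonneg (d := d) hf hσ
  set a := constA d R₁ R₂ m σ + constB d R₁ m σ * 0 ^ m
  set c := constC d R₁ m σ
  have hg := (hf.measurable_smoothingGrad hσ).comp_aemeasurable hX
  refine ((((integrable_const (‖smoothingGrad f σ 0‖ ^ 2)).add ((hmom 2).const_mul (a ^ 2))).add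
    ((hmom ((m + 1) * 2)).const_mul (c ^ 2))).const_mul ((3 : ℝ) ^ (2 - 1))).mono'
    ((((hX.norm.pow_const m).add_const 1).inv.smul hg).norm.pow_const 2).aestronglyMeasurable
    (Eventually.of_forall fun ω => ?_)
  have h1 : ‖(‖X ω‖ ^ m + 1)⁻¹ • smoothingGrad f σ (X ω)‖ ≤ ‖smoothingGrad f σ (X ω)‖ := by
    rw [norm_smul, Real.norm_of_nonneg (by positivity)]
    exact mul_le_of_le_one_left (norm_nonneg _)
      (inv_le_one_of_one_le₀ (le_add_of_nonneg_left (by positivity)))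
  rw [Real.norm_of_nonneg (by positivity)]
  refine (pow_le_pow_left₀ (norm_nonneg _) (h1.trans (hf.norm_smoothingGrad_le hσ (X ω))) 2).trans ?_
  refine (add_add_pow_le (by positivity) (by positivity) (by positivity) two_ne_zero).trans_eq ?_
  simp only [Pi.add_apply, mul_pow, ← pow_mul, a, c]

/-- Expected decrease of the smoothing along one step of the method. -/
lemma IsSPB.integral_smoothing_iterates_succ_le [IsProbabilityMeasure P] (hf : IsSPB f R₁ R₂ m)
    (hbdd : BddBelow (Set.range f)) (hσ : 0 < σ) {τ : ℕ → ℝ} (hτ : ∀ k, τ k ∈ Set.Ioc (0 : ℝ) 1)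
    (x₀ : Vec d) (hu : ∀ k, HasLaw (u k) (gauss d) P) (hindep : iIndepFun u P) (k : ℕ) :
    ∫ ω, smoothing f σ (iterates f m σ τ x₀ (fun j => u j ω) (k + 1)) ∂P ≤
      ∫ ω, smoothing f σ (iterates f m σ τ x₀ (fun j => u j ω) k) ∂P -
      τ k * ∫ ω, ‖(‖iterates f m σ τ x₀ (fun j => u j ω) k‖ ^ m + 1)⁻¹ •
        smoothingGrad f σ (iterates f m σ τ x₀ (fun j => u j ω) k)‖ ^ 2 ∂P +
      (constH d R₁ R₂ m σ 2 * τ k ^ 2 * (constA d R₁ R₂ m σ + constB d R₁ m σ) / 2 +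
        constC d R₁ m σ / ((m : ℝ) + 2) * constH d R₁ R₂ m σ (m + 2) * τ k ^ (m + 2)) := by
  set X : Ω → Vec d := fun ω => iterates f m σ τ x₀ (fun j => u j ω) k with hXdef
  set c := constH d R₁ R₂ m σ 2 * τ k ^ 2 * (constA d R₁ R₂ m σ + constB d R₁ m σ) / 2 +
    constC d R₁ m σ / ((m : ℝ) + 2) * constH d R₁ R₂ m σ (m + 2) * τ k ^ (m + 2)
  have hum := fun k => (hu k).aemeasurable
  have hX : AEMeasurable X P := hf.aemeasurable_iterates τ x₀ hum k
  have hmom := fun k => hf.integrable_norm_iterates_pow hσ hτ x₀ hu k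
  have hI := hf.integrable_smoothing_of_moments hσ hX (hmom k)
  have hG := hf.integrable_norm_smoothingGrad_sq_of_moments hσ hX (hmom k)
  have hprob : IsProbabilityMeasure (P.map X) := Measure.isProbabilityMeasure_map hX
  set F : Vec d × Vec d → ℝ :=
    fun p => smoothing f σ (p.1 - stepSize m (τ k) p.1 • estimator f σ p.1 p.2)
  have hFm : Measurable F :=
    ((hf.continuous_smoothing hσ).comp (hf.continuous_step (τ k))).measurable
  -- Independence gives a product law, so Fubini replaces conditioning on the past and the
  -- fixed-point estimate applies to the inner integral.
  have hlaw : P.map (fun ω => (X ω, u k ω)) = (P.map X).prod (gauss d) := by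
    rw [(indepFun_iff_map_prod_eq_prod_map_map hX (hum k)).1
      (hf.indepFun_iterates τ x₀ hum hindep k), (hu k).map_eq]
  have hpair : AEMeasurable (fun ω => (X ω, u k ω)) P := hX.prodMk (hum k)
  have hFint : Integrable F ((P.map X).prod (gauss d)) := by
    rw [← hlaw, integrable_map_measure hFm.aestronglyMeasurable hpair]
    exact hf.integrable_smoothing_of_moments hσ (hf.aemeasurable_iterates τ x₀ hum (k + 1))
      (hmom (k + 1))
  have hsm : Measurable (smoothing f σ) := (hf.continuous_smoothing hσ).measurable
  have hgm := hf.measurable_smoothingGrad hσ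
  set K : Vec d → ℝ := fun y => smoothing f σ y -
    τ k * ‖(‖y‖ ^ m + 1)⁻¹ • smoothingGrad f σ y‖ ^ 2 + c with hK
  have hKm : Measurable K := by fun_prop
  have hKi : Integrable (K ∘ X) P := (hI.sub (hG.const_mul (τ k))).add (integrable_const c)
  calc ∫ ω, smoothing f σ (iterates f m σ τ x₀ (fun j => u j ω) (k + 1)) ∂P
      = ∫ ω, F (X ω, u k ω) ∂P := rfl
    _ = ∫ p, F p ∂((P.map X).prod (gauss d)) := by
        rw [← hlaw, integral_map hpair hFm.aestronglyMeasurable]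
    _ = ∫ y, ∫ v, F (y, v) ∂(gauss d) ∂(P.map X) := integral_prod F hFint
    _ ≤ ∫ y, K y ∂(P.map X) :=
        integral_mono hFint.integral_prod_left
          ((integrable_map_measure hKm.aestronglyMeasurable hX).2 hKi)
          fun y => hf.integral_smoothing_step_le hbdd hσ y (hτ k).1
    _ = ∫ ω, K (X ω) ∂P := integral_map hX hKm.aestronglyMeasurable
    _ = _ := by
        have hS : Integrable (fun ω => smoothing f σ (X ω) -
          τ k * ‖(‖X ω‖ ^ m + 1)⁻¹ • smoothingGrad f σ (X ω)‖ ^ 2) P := hI.sub (hG.const_mul (τ k))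
        simp only [hK]
        rw [integral_add hS (integrable_const c), integral_sub hI (hG.const_mul (τ k)),
          integral_const_mul]
        simp [hXdef]

end Trajectory

/-! ### Telescoping and the final bound. -/

lemma inf'_mul_sum_le {a N c t : ℕ → ℝ} {ℓ : ℝ} (ht : ∀ k, 0 ≤ t k) (hℓ : ∀ k, ℓ ≤ a k)
    (h : ∀ k, a (k + 1) ≤ a k - t k * N k + c k) (T : ℕ) :
    (Finset.range (T + 1)).inf' Finset.nonempty_range_add_one N *
      ∑ k ∈ Finset.range (T + 1), t k ≤ a 0 - ℓ + ∑ k ∈ Finset.range (T + 1), c k := by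
  have h1 : (Finset.range (T + 1)).inf' Finset.nonempty_range_add_one N *
      ∑ k ∈ Finset.range (T + 1), t k ≤ ∑ k ∈ Finset.range (T + 1), t k * N k := by
    rw [Finset.mul_sum]
    refine Finset.sum_le_sum fun k hk => ?_
    rw [mul_comm]
    exact mul_le_mul_of_nonneg_left (Finset.inf'_le N hk) (ht k)
  have h2 : ∑ k ∈ Finset.range (T + 1), t k * N k ≤
      ∑ k ∈ Finset.range (T + 1), (a k - a (k + 1) + c k) :=
    Finset.sum_le_sum fun k _ => by linarith [h k]
  rw [Finset.sum_add_distrib, Finset.sum_range_sub'] at h2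
  linarith [hℓ (T + 1)]

end SPB

end

theorem theorem4p8 {d : ℕ} (f : EuclideanSpace ℝ (Fin d) → ℝ) (R₁ R₂ : ℝ) (m : ℕ)
    (hf : SPB.IsSPB f R₁ R₂ m) (hbdd : BddBelow (Set.range f))
    (σ : ℝ) (hσ : 0 < σ) (τ : ℕ → ℝ) (hτ : ∀ k, τ k ∈ Set.Ioc (0 : ℝ) 1)
    (x₀ : EuclideanSpace ℝ (Fin d))
    {Ω : Type*} [MeasurableSpace Ω] (P : Measure Ω) [IsProbabilityMeasure P]
    (u : ℕ → Ω → EuclideanSpace ℝ (Fin d))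
    (hu : ∀ k, HasLaw (u k) (stdGaussian (EuclideanSpace ℝ (Fin d))) P)
    (hindep : iIndepFun u P)
    (x : ℕ → Ω → EuclideanSpace ℝ (Fin d))
    (hx : ∀ k ω, x k ω = SPB.iterates f m σ τ x₀ (fun j => u j ω) k) :
    -- the smoothing and its gradient formula are well defined
    (∀ y, Integrable (fun v => f (y + σ • v)) (stdGaussian (EuclideanSpace ℝ (Fin d)))) ∧
    (∀ y, Integrable (fun v => f (y + σ • v) • v) (stdGaussian (EuclideanSpace ℝ (Fin d)))) ∧
    (∀ y, HasGradientAt (SPB.smoothing f σ)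
      (σ⁻¹ • ∫ v, f (y + σ • v) • v ∂(stdGaussian (EuclideanSpace ℝ (Fin d)))) y) ∧
    -- the expectations below are those of integrable random variables
    (∀ k, Integrable (fun ω => SPB.smoothing f σ (x k ω)) P) ∧
    (∀ k, Integrable
      (fun ω => ‖(‖x k ω‖ ^ m + 1)⁻¹ • gradient (SPB.smoothing f σ) (x k ω)‖ ^ 2) P) ∧
    -- one-step expected descent
    (∀ k, ∫ ω, SPB.smoothing f σ (x (k + 1) ω) ∂P ≤
      ∫ ω, SPB.smoothing f σ (x k ω) ∂P +
        SPB.constH d R₁ R₂ m σ 2 * τ k ^ 2 *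
          (SPB.constA d R₁ R₂ m σ + SPB.constB d R₁ m σ) / 2 +
        SPB.constC d R₁ m σ / ((m : ℝ) + 2) *
          SPB.constH d R₁ R₂ m σ (m + 2) * τ k ^ (m + 2)) ∧
    -- complexity bound
    (∀ T : ℕ, 0 < T →
      (Finset.range (T + 1)).inf' Finset.nonempty_range_add_one
          (fun k => ∫ ω, ‖(‖x k ω‖ ^ m + 1)⁻¹ •
            gradient (SPB.smoothing f σ) (x k ω)‖ ^ 2 ∂P) ≤
        (SPB.constM R₁ R₂ m σ x₀ * σ + f x₀ - (⨅ y, f y) +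
            (1 / 2) * SPB.constH d R₁ R₂ m σ 2 *
              (SPB.constA d R₁ R₂ m σ + SPB.constB d R₁ m σ) *
              ∑ k ∈ Finset.range (T + 1), τ k ^ 2 +
            SPB.constH d R₁ R₂ m σ (m + 2) * SPB.constC d R₁ m σ / ((m : ℝ) + 2) *
              ∑ k ∈ Finset.range (T + 1), τ k ^ (m + 2)) /
          ∑ k ∈ Finset.range (T + 1), τ k) := by
  have hx' : ∀ k, x k = fun ω => SPB.iterates f m σ τ x₀ (fun j => u j ω) k := fun k =>
    funext (hx k)
  have hgrad := hf.gradient_smoothing hσ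
  have hmom := fun k => hf.integrable_norm_iterates_pow hσ hτ x₀ hu k
  have hX := fun k => hf.aemeasurable_iterates (σ := σ) τ x₀ (fun k => (hu k).aemeasurable) k
  have hI := fun k => hf.integrable_smoothing_of_moments hσ (hX k) (hmom k)
  have hG := fun k => hf.integrable_norm_smoothingGrad_sq_of_moments hσ (hX k) (hmom k)
  have hstep := hf.integral_smoothing_iterates_succ_le hbdd hσ hτ x₀ hu hindep
  simp only [hx', hgrad]
  refine ⟨hf.integrable_comp hσ, hf.integrable_comp_smul hσ, hf.hasGradientAt_smoothing hσ,
    hI, hG, fun k => ?_, fun T _ => ?_⟩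
  -- The one-step claim simply drops the nonnegative gradient term.
  · have h1 := mul_nonneg (hτ k).1.le (integral_nonneg (μ := P) fun ω => sq_nonneg
      ‖(‖SPB.iterates f m σ τ x₀ (fun j => u j ω) k‖ ^ m + 1)⁻¹ •
        SPB.smoothingGrad f σ (SPB.iterates f m σ τ x₀ (fun j => u j ω) k)‖)
    linarith [hstep k]
  · rw [le_div_iff₀ (Finset.sum_pos (fun k _ => (hτ k).1) Finset.nonempty_range_add_one)]
    refine (SPB.inf'_mul_sum_le
      (a := fun k => ∫ ω, SPB.smoothing f σ (SPB.iterates f m σ τ x₀ (fun j => u j ω) k) ∂P)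
      (c := fun k => SPB.constH d R₁ R₂ m σ 2 * τ k ^ 2 *
          (SPB.constA d R₁ R₂ m σ + SPB.constB d R₁ m σ) / 2 +
        SPB.constC d R₁ m σ / ((m : ℝ) + 2) * SPB.constH d R₁ R₂ m σ (m + 2) * τ k ^ (m + 2))
      (ℓ := ⨅ y, f y) (fun k => (hτ k).1.le) (fun k => ?_) hstep T).trans ?_
    · simpa using integral_mono (integrable_const (⨅ y, f y)) (hI k)
        fun ω => hf.iInf_le_smoothing hbdd hσ _
    -- The telescoped sum starts at f_σ(x⁰), since x⁰ is deterministic; the approximation error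
    -- trades it for f(x⁰) + ℳ(x⁰)σ.
    · have h0 := (abs_le.1 (hf.abs_smoothing_sub_le hσ x₀)).2
      simp only [SPB.iterates, integral_const, probReal_univ, one_smul]
      rw [Finset.sum_add_distrib, ← Finset.mul_sum, ← Finset.sum_div, ← Finset.sum_mul,
        ← Finset.mul_sum]
      exact (add_le_add (sub_le_sub_right (sub_le_iff_le_add.1 h0) _) le_rfl).trans_eq (by ring)
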